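/- Let $\tau$ be in the upper half-plane, let $\wp,\zeta$ be the Weierstrass functions of the lattice $\Lambda=\mathbb Z+\mathbb Z\tau$ with invariants $g_2,g_3$, and let $\gamma=[\tfrac{\tau}{2},\tfrac{\tau}{2}+1]$. A monic elliptic polynomial of degree $m$ is an elliptic function with periods $1,\tau$, with poles only on $\Lambda$, and with $\pi(z)=z^{-m}(1+\mathcal O(z))$ as $z\to0$. Put $\mathcal E_{2k}=\wp^k$, $\mathcal E_{2k+3}=-\tfrac12\wp'\wp^k$ $(k\ge 0)$, $\mu_{i,j}=\int_\gamma\mathcal E_i\mathcal E_j\,dz$ and $D_m=\det(\mu_{i,j})_{i,j\in\{0,2,3,\dots,m-1\}}$. The elliptic orthogonal polynomial $\pi_m$ (for the constant weight $1$) is the monic elliptic polynomial of degree $m$ with $\int_\gamma\pi_m\mathcal E_k\,dz=0$ for all $k<m$, $k\ne1$. Put $h_m=\int_\gamma\pi_m^2\,dz$, $\beta_m=h_m/h_{m-1}$, and $\mathcal C(\pi_m)(z)=\frac1{2\pi i}\int_\gamma\pi_m(w)\,(\zeta(w-z)-\zeta(w))\,dw$, and define $c_{j,m}$, $\tilde c_{j,m}$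 by the expansions $$\pi_m(z)=\sum_{j\ge0}c_{j,m}z^{j-m},\qquad \mathcal C(\pi_m)(z)=\frac{h_m}{2\pi i}\sum_{j\ge0}\tilde c_{j,m}z^{m+j-1}\qquad(z\to0).$$ Put $\alpha_m=c_{2,m}+\tilde c_{2,m-1}-\beta_m$. For sequences $(\alpha_m)$, $(h_m)$ write $f_m(z)=\wp(z)+\alpha_m$ and $$R_m=\frac1{f_m}\begin{pmatrix}-\wp'/2&-\frac{h_m}{2\pi i}f_{m+1}\\ \frac{2\pi i}{h_m}f_m&0\end{pmatrix},\qquad L_m=\frac1{f_m}\begin{pmatrix}m\wp'/2&\frac{h_m}{2\pi i}\big((m-1)f_m+mf_{m+1}\big)\\ \frac{2\pi i}{h_{m-1}}\big((2-m)f_{m-1}+(1-m)f_m\big)&(2-m)\wp'/2\end{pmatrix}.$$ **Theorem.** Let $n\ge4$. (a) Let $(\alpha_m)$, $(h_m)$ be any complex sequences with $h_{n-1},h_n\neq0$, and put $\beta_n=h_n/h_{n-1}$. If the compatibility condition $$R_n'-L_{n+1}R_n+R_nL_n=0\qquad({}'=d/dz)$$ holds at all $z\notin\Lambda$ with $f_n(z)f_{n+1}(z)\ne0$,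 then $$\beta_n=\frac{g_3-g_2\alpha_n+4\alpha_n^3}{4(\alpha_{n-1}-\alpha_n)(\alpha_n-\alpha_{n+1})},$$ $$\alpha_{n+1}=\frac{(1-n)\alpha_n(4\alpha_n^3-3g_2\alpha_n+4g_3)-\alpha_{n-1}\big(4(n-2)\alpha_n^3+ng_2\alpha_n-(2n-1)g_3\big)}{4n\alpha_n^3+(n-1)\alpha_{n-1}(g_2-12\alpha_n^2)+g_2(n-2)\alpha_n-g_3(2n-3)}.$$ Both relations hold without any restriction after multiplication by their denominators, and as written whenever the denominator in question is nonzero; both denominators are nonzero if $g_3-g_2\alpha_n+4\alpha_n^3\ne0$. (b) If $D_m\ne0$ for $n-2\le m\le n+2$, then the coefficients $\alpha_m,h_m,\beta_m$ of the elliptic orthogonal polynomials satisfy the compatibility condition in (a), and hence both recurrence relations in the same sense. -/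

import Mathlib

noncomputable section

namespace EllipticOP

open Asymptotics Filter Topology PeriodPair

/-- The pair of periods `(1, τ)`, for `τ` in the upper half-plane. -/
def periods (τ : UpperHalfPlane) : PeriodPair where
  ω₁ := 1
  ω₂ := (τ : ℂ)
  indep := by
    rw [LinearIndependent.pair_iff]
    intro s t h
    have him := congrArg Complex.im h
    have ht : t = 0 := by
      simpa [τ.im_ne_zero] using him
    subst ht
    have hre := congrArg Complex.re h
    exact ⟨by simpa using hre, rfl⟩

/-- The Weierstrass function `℘(z, τ)` with periods `1` and `τ`. -/
def wp (τ : UpperHalfPlane) (z : ℂ) : ℂ := (periods τ).weierstrassP z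

/-- The derivative `℘'(z, τ)`. -/
def wp' (τ : UpperHalfPlane) (z : ℂ) : ℂ := (periods τ).derivWeierstrassP z

/-- The Weierstrass zeta function `ζ(z) = 1/z + ∑_{l ≠ 0} (1/(z-l) + 1/l + z/l²)` of the lattice
`ℤ + ℤτ`. (The summand of `l = 0` is `1/z`, because `1/0 = 0`.) -/
def wzeta (τ : UpperHalfPlane) (z : ℂ) : ℂ :=
  ∑' l : (periods τ).lattice, (1 / (z - l) + 1 / (l : ℂ) + z / (l : ℂ) ^ 2)

/-- The integral `∫_γ f(z) dz` over the segment `γ = [τ/2, τ/2 + 1]`. -/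
def gammaInt (τ : UpperHalfPlane) (f : ℂ → ℂ) : ℂ :=
  ∫ x in (0 : ℝ)..1, f ((τ : ℂ) / 2 + (x : ℂ))

/-- The basis elements `ℰ_{2k} = ℘^k`, `ℰ_{2k+3} = -½ ℘' ℘^k` of the space of elliptic polynomials.
The index `1` is not used. -/
def basisFun (τ : UpperHalfPlane) (n : ℕ) (z : ℂ) : ℂ :=
  if Even n then wp τ z ^ (n / 2) else -(1 / 2) * wp' τ z * wp τ z ^ ((n - 3) / 2)

/-- The moments `μ_{i,j} = ∫_γ ℰ_i ℰ_j dz` of the constant weight `1`. -/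
def moment (τ : UpperHalfPlane) (i j : ℕ) : ℂ :=
  gammaInt τ fun z => basisFun τ i z * basisFun τ j z

/-- The increasing enumeration `0, 2, 3, 4, …` of the natural numbers different from `1`. -/
def skipOne (i : ℕ) : ℕ := if i = 0 then 0 else i + 1

/-- The determinant `D_n` of the moments `μ_{i,j}`, with `i, j` in `{0, 2, 3, …, n - 1}`. -/
def momentDet (τ : UpperHalfPlane) (n : ℕ) : ℂ :=
  Matrix.det (Matrix.of fun i j : Fin (n - 1) => moment τ (skipOne i) (skipOne j))

/-- `p` is a monic elliptic polynomial of degree `n`: an elliptic function with periods `1`, `τ`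
whose poles all lie on the lattice, and such that `p(z) = z⁻ⁿ (1 + O(z))` as `z → 0`.
(The values of `p` at the lattice points themselves play no role.) -/
structure IsMonicEllipticPoly (τ : UpperHalfPlane) (n : ℕ) (p : ℂ → ℂ) : Prop where
  periodic_one : ∀ z, p (z + 1) = p z
  periodic_tau : ∀ z, p (z + (τ : ℂ)) = p z
  holo : DifferentiableOn ℂ p ((periods τ).lattice : Set ℂ)ᶜ
  mero : ∀ l ∈ (periods τ).lattice, MeromorphicAt p l
  monic : (fun z => z ^ n * p z - 1) =O[𝓝[≠] (0 : ℂ)] fun z => z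

/-- `p` is the elliptic orthogonal polynomial of degree `n` for the constant weight on `γ`:
monic of degree `n` and orthogonal to all elliptic polynomials of lower degree. -/
structure IsEOP (τ : UpperHalfPlane) (n : ℕ) (p : ℂ → ℂ) : Prop where
  monicPoly : IsMonicEllipticPoly τ n p
  orthogonal : ∀ k, k < n → k ≠ 1 → gammaInt τ (fun z => p z * basisFun τ k z) = 0

/-- `h_n = ∫_γ π_n² dz`. -/
def normConst (τ : UpperHalfPlane) (π : ℕ → ℂ → ℂ) (n : ℕ) : ℂ :=
  gammaInt τ fun z => π n z ^ 2

/-- The Cauchy transform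
`𝒞(p)(z) = (2πi)⁻¹ ∫_γ p(w) (ζ(w - z) - ζ(w)) dw`. -/
def cauchyTransform (τ : UpperHalfPlane) (p : ℂ → ℂ) (z : ℂ) : ℂ :=
  (2 * (Real.pi : ℂ) * Complex.I)⁻¹ *
    gammaInt τ fun w => p w * (wzeta τ (w - z) - wzeta τ w)

/-- The coefficient `c_{j,n}` in `π_n(z) = ∑_j c_{j,n} z^{j-n}` (`z → 0`), i.e. the `j`-th Taylor
coefficient at `0` of `z^n π_n(z)`, extended to `z = 0` by its limit `c_{0,n} = 1`. -/
def laurentCoeff (π : ℕ → ℂ → ℂ) (j n : ℕ) : ℂ :=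
  iteratedDeriv j (Function.update (fun z : ℂ => z ^ n * π n z) 0 1) 0 / (j.factorial : ℂ)

/-- The coefficient `c̃_{j,n}` in
`𝒞(π_n)(z) = (h_n / 2πi) ∑_j c̃_{j,n} z^{n+j-1}` (`z → 0`), for `n ≥ 2`. -/
def cauchyCoeff (τ : UpperHalfPlane) (π : ℕ → ℂ → ℂ) (j n : ℕ) : ℂ :=
  2 * (Real.pi : ℂ) * Complex.I / normConst τ π n *
    (iteratedDeriv (n + j - 1) (cauchyTransform τ (π n)) 0 / ((n + j - 1).factorial : ℂ))

/-- The quotients `β_n = h_n / h_{n-1}` of a sequence `h`. -/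
def ratio (h : ℕ → ℂ) (n : ℕ) : ℂ := h n / h (n - 1)

/-- `α_n = c_{2,n} + c̃_{2,n-1} - β_n`. -/
def alpha (τ : UpperHalfPlane) (π : ℕ → ℂ → ℂ) (n : ℕ) : ℂ :=
  laurentCoeff π 2 n + cauchyCoeff τ π 2 (n - 1) - ratio (normConst τ π) n

/-- `f_n(z) = ℘(z) + α_n`. -/
def fFun (τ : UpperHalfPlane) (α : ℕ → ℂ) (n : ℕ) (z : ℂ) : ℂ := wp τ z + α n

/-- The matrix `R_n(z)` of the difference equation `Y_{n+1} = R_n Y_n`, formed from sequences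
`α` and `h`. -/
def RMat (τ : UpperHalfPlane) (α h : ℕ → ℂ) (n : ℕ) (z : ℂ) : Matrix (Fin 2) (Fin 2) ℂ :=
  (1 / fFun τ α n z) •
    !![-(wp' τ z) / 2, -(h n / (2 * (Real.pi : ℂ) * Complex.I)) * fFun τ α (n + 1) z;
       2 * (Real.pi : ℂ) * Complex.I / h n * fFun τ α n z, 0]

/-- The matrix `L_n(z)` of the differential equation `Y_n' = L_n Y_n`, formed from sequences
`α` and `h`. -/
def LMat (τ : UpperHalfPlane) (α h : ℕ → ℂ) (n : ℕ) (z : ℂ) : Matrix (Fin 2) (Fin 2) ℂ :=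
  (1 / fFun τ α n z) •
    !![(n : ℂ) * wp' τ z / 2,
       h n / (2 * (Real.pi : ℂ) * Complex.I) *
         (((n : ℂ) - 1) * fFun τ α n z + (n : ℂ) * fFun τ α (n + 1) z);
       2 * (Real.pi : ℂ) * Complex.I / h (n - 1) *
         ((2 - (n : ℂ)) * fFun τ α (n - 1) z + (1 - (n : ℂ)) * fFun τ α n z),
       (2 - (n : ℂ)) * wp' τ z / 2]

/-- The compatibility condition `R_n' - L_{n+1} R_n + R_n L_n = 0`, at all points `z` at which the
matrices have no pole; `'` is the entrywise derivative in `z`. -/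
def Compatible (τ : UpperHalfPlane) (α h : ℕ → ℂ) (n : ℕ) : Prop :=
  ∀ z : ℂ, z ∉ (periods τ).lattice → fFun τ α n z ≠ 0 → fFun τ α (n + 1) z ≠ 0 →
    (Matrix.of fun i j => deriv (fun w => RMat τ α h n w i j) z)
      - LMat τ α h (n + 1) z * RMat τ α h n z + RMat τ α h n z * LMat τ α h n z = 0

/-- The numerator `g₃ - g₂ α_n + 4 α_n³` of the formula for `β_n`. -/
def betaNum (g₂ g₃ : ℂ) (α : ℕ → ℂ) (n : ℕ) : ℂ := g₃ - g₂ * α n + 4 * α n ^ 3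

/-- The denominator of the formula for `β_n`. -/
def betaDen (α : ℕ → ℂ) (n : ℕ) : ℂ := 4 * (α (n - 1) - α n) * (α n - α (n + 1))

/-- The numerator of the formula for `α_{n+1}`. -/
def alphaNum (g₂ g₃ : ℂ) (α : ℕ → ℂ) (n : ℕ) : ℂ :=
  (1 - (n : ℂ)) * α n * (4 * α n ^ 3 - 3 * g₂ * α n + 4 * g₃)
    - α (n - 1) * (4 * ((n : ℂ) - 2) * α n ^ 3 + (n : ℂ) * g₂ * α n - (2 * (n : ℂ) - 1) * g₃)

/-- The denominator of the formula for `α_{n+1}`. -/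
def alphaDen (g₂ g₃ : ℂ) (α : ℕ → ℂ) (n : ℕ) : ℂ :=
  4 * (n : ℂ) * α n ^ 3 + ((n : ℂ) - 1) * α (n - 1) * (g₂ - 12 * α n ^ 2)
    + g₂ * ((n : ℂ) - 2) * α n - g₃ * (2 * (n : ℂ) - 3)

/-- The recurrence relations for `β_n` and `α_{n+1}`: cleared of denominators, without any
restriction; the denominators do not vanish if `g₃ - g₂ α_n + 4 α_n³ ≠ 0`; and as quotients wherever
the denominators do not vanish. -/
structure Recurrences (g₂ g₃ : ℂ) (α β : ℕ → ℂ) (n : ℕ) : Prop where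
  beta_mul : β n * betaDen α n = betaNum g₂ g₃ α n
  alpha_mul : α (n + 1) * alphaDen g₂ g₃ α n = alphaNum g₂ g₃ α n
  den_ne_zero : betaNum g₂ g₃ α n ≠ 0 → betaDen α n ≠ 0 ∧ alphaDen g₂ g₃ α n ≠ 0
  beta_eq : betaDen α n ≠ 0 → β n = betaNum g₂ g₃ α n / betaDen α n
  alpha_eq : alphaDen g₂ g₃ α n ≠ 0 → α (n + 1) = alphaNum g₂ g₃ α n / alphaDen g₂ g₃ α n

end EllipticOP

end

/-! For (a), the left side of the compatibility condition is a matrix with a single nontrivial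
entry, `compatPoly` evaluated at `℘`, over `4 f_n² f_{n+1}` (`compat_matrix`). Since `℘` has a pole
at `0`, the condition says exactly that this polynomial of degree at most 4 vanishes identically.
The terms with `β_{n+1}` and `α_{n+2}` have a double zero at `x = -α_n`, so the value and the first
derivative there give two equations in `β_n, α_{n-1}, α_n, α_{n+1}` alone. Solving them yields both
recurrences (`recurrences_of_compatPoly`).

For (b), two relations among orthogonal polynomials are proved: `f_n π_{n+1} + (℘'/2) π_n + β_n
f_{n+1} π_{n-1} = 0` (`OrthPoly.three_term`) and a formula for `f_n π_n'` in terms of `π_n, π_{n-1}`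
(`OrthPoly.deriv_relation`). They are the first columns of `Y_{n+1} = R_n Y_n` and `Y_n' = L_n Y_n`.
In each, the difference of the two sides has its top Laurent coefficients cancelled, so its degree
is at most `n - 1`, and it is orthogonal to everything of that degree; the nonzero determinant `D_n`
forces it to vanish. The inputs are the second Laurent coefficients, the second coefficients of the
Cauchy transforms (`IsEOP.hasTail`), and integration by parts on `γ`, which has no boundary term.
Differentiating the first relation and eliminating derivatives by the second leaves `compatPoly(℘)
π_n = 0` (`compatible_of_isEOP`). The first column suffices because only one matrix entry is in
question. -/

noncomputable section

namespace EllipticOP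

open Filter Topology PeriodPair

/-! ### Elliptic functions, Liouville's theorem and Laurent expansions at `0`. -/

/-- Functions with period lattice `L` that are holomorphic off `L`. -/
structure IsElliptic (L : PeriodPair) (X : ℂ → ℂ) : Prop where
  add_coe : ∀ l ∈ L.lattice, ∀ z, X (z + l) = X z
  diff : DifferentiableOn ℂ X (L.lattice : Set ℂ)ᶜ

/-- `z ^ N * X z` extends analytically to `0`, with value `a` there. -/
def Lead (N : ℕ) (a : ℂ) (X : ℂ → ℂ) : Prop :=
  ∃ g : ℂ → ℂ, AnalyticAt ℂ g 0 ∧ g 0 = a ∧ ∀ᶠ z in 𝓝[≠] (0 : ℂ), z ^ N * X z = g z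

/-- `z ^ N * X z = a + b z² + O(z⁴)`, the remainder being analytic at `0`. -/
def Jet (N : ℕ) (a b : ℂ) (X : ℂ → ℂ) : Prop :=
  ∃ g : ℂ → ℂ, AnalyticAt ℂ g 0 ∧
    ∀ᶠ z in 𝓝[≠] (0 : ℂ), z ^ N * X z = a + b * z ^ 2 + z ^ 4 * g z

variable {L : PeriodPair} {X Y : ℂ → ℂ} {N M : ℕ} {a b c d : ℂ}

lemma notMem_lattice_of_near_zero (L : PeriodPair) : ∀ᶠ z in 𝓝[≠] (0 : ℂ), z ∉ L.lattice := by
  filter_upwards [self_mem_nhdsWithin, mem_nhdsWithin_of_mem_nhds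
    (L.compl_lattice_sdiff_singleton_mem_nhds 0)] with z hz hz'
  simp_all

lemma tendsto_neg_punctured : Tendsto (fun z : ℂ => -z) (𝓝[≠] 0) (𝓝[≠] 0) := by
  refine tendsto_nhdsWithin_iff.mpr ⟨?_, ?_⟩
  · have : ContinuousAt (fun z : ℂ => -z) 0 := by fun_prop
    simpa [ContinuousAt] using this.tendsto.mono_left nhdsWithin_le_nhds
  · filter_upwards [self_mem_nhdsWithin] with z hz
    simpa using hz

namespace IsElliptic

lemma const (c : ℂ) : IsElliptic L fun _ => c := ⟨fun _ _ _ => rfl, by fun_prop⟩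

lemma add (hX : IsElliptic L X) (hY : IsElliptic L Y) : IsElliptic L fun z => X z + Y z :=
  ⟨fun l hl z => by simp only [hX.add_coe l hl, hY.add_coe l hl], hX.diff.add hY.diff⟩

lemma mul (hX : IsElliptic L X) (hY : IsElliptic L Y) : IsElliptic L fun z => X z * Y z :=
  ⟨fun l hl z => by simp only [hX.add_coe l hl, hY.add_coe l hl], hX.diff.mul hY.diff⟩

lemma const_mul (c : ℂ) (hX : IsElliptic L X) : IsElliptic L fun z => c * X z :=
  (const c).mul hX

lemma sub (hX : IsElliptic L X) (hY : IsElliptic L Y) : IsElliptic L fun z => X z - Y z :=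
  ⟨fun l hl z => by simp only [hX.add_coe l hl, hY.add_coe l hl], hX.diff.sub hY.diff⟩

lemma pow (hX : IsElliptic L X) (k : ℕ) : IsElliptic L fun z => X z ^ k :=
  ⟨fun l hl z => by simp only [hX.add_coe l hl], hX.diff.pow k⟩

lemma comp_neg (hX : IsElliptic L X) : IsElliptic L fun z => X (-z) := by
  refine ⟨fun l hl z => ?_, ?_⟩
  · rw [neg_add, hX.add_coe _ (neg_mem hl)]
  · exact hX.diff.comp (by fun_prop) fun z hz h => hz (by simpa using neg_mem h)

lemma differentiableAt (hX : IsElliptic L X) {z : ℂ} (hz : z ∉ L.lattice) :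
    DifferentiableAt ℂ X z :=
  hX.diff.differentiableAt (L.isClosed_lattice.isOpen_compl.mem_nhds hz)

lemma deriv (hX : IsElliptic L X) : IsElliptic L (deriv X) := by
  refine ⟨fun l hl z => ?_, hX.diff.deriv L.isClosed_lattice.isOpen_compl⟩
  rw [← deriv_comp_add_const]
  exact congrArg (fun f => _root_.deriv f z) (funext (hX.add_coe l hl))

/-- Liouville's theorem. -/
lemma eq_const (hX : IsElliptic L X) (h0 : Lead 0 a X) {z : ℂ} (hz : z ∉ L.lattice) : X z = a := by
  classical
  obtain ⟨g, hg, hga, hgX⟩ := h0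
  -- The values of `X` on the lattice are arbitrary, so they are replaced by the limit `a` to obtain
  -- an entire function.
  set F : ℂ → ℂ := fun w => if w ∈ L.lattice then a else X w with hF
  have hper : ∀ w, ∀ l ∈ L.lattice, F (w + l) = F w := fun w l hl => by
    have : w + l ∈ L.lattice ↔ w ∈ L.lattice := L.lattice.add_mem_iff_left hl
    simp only [hF, this, hX.add_coe l hl]
  have h00 : DifferentiableAt ℂ F 0 := by
    refine hg.differentiableAt.congr_of_eventuallyEq ?_
    have := eventually_nhdsWithin_iff.mp (hgX.and (notMem_lattice_of_near_zero L))
    filter_upwards [this] with w hw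
    by_cases h : w = 0
    · simp [hF, h, hga]
    · have := hw h
      simp only [hF, if_neg this.2, ← this.1, pow_zero, one_mul]
  have hd : Differentiable ℂ F := fun w => by
    by_cases hw : w ∈ L.lattice
    · have h1 : F = fun u => F (u - w) := funext fun u => by
        rw [← hper (u - w) w hw, sub_add_cancel]
      rw [h1]
      have h2 : DifferentiableAt ℂ F (w - w) := by rwa [sub_self]
      exact DifferentiableAt.comp (g := F) (f := fun u => u - w) w h2 (by fun_prop)
    · refine (hX.differentiableAt hw).congr_of_eventuallyEq ?_
      filter_upwards [L.isClosed_lattice.isOpen_compl.mem_nhds hw] with u hu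
      exact if_neg hu
  have := hd.apply_eq_apply_of_bounded (IsZLattice.isCompact_range_of_periodic L.lattice _
    hd.continuous hper).isBounded z 0
  simpa [hF, hz] using this

end IsElliptic

namespace Lead

lemma const (c : ℂ) : Lead 0 c fun _ => c := ⟨fun _ => c, analyticAt_const, rfl, by simp⟩

lemma add (hX : Lead N a X) (hY : Lead N b Y) : Lead N (a + b) fun z => X z + Y z := by
  obtain ⟨g, hg, hga, hgX⟩ := hX
  obtain ⟨k, hk, hka, hkY⟩ := hY
  refine ⟨fun z => g z + k z, hg.add hk, by simp [hga, hka], ?_⟩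
  filter_upwards [hgX, hkY] with z h1 h2
  rw [mul_add, h1, h2]

lemma mul (hX : Lead N a X) (hY : Lead M b Y) : Lead (N + M) (a * b) fun z => X z * Y z := by
  obtain ⟨g, hg, hga, hgX⟩ := hX
  obtain ⟨k, hk, hka, hkY⟩ := hY
  refine ⟨fun z => g z * k z, hg.mul hk, by simp [hga, hka], ?_⟩
  filter_upwards [hgX, hkY] with z h1 h2
  rw [← h1, ← h2]; ring

lemma const_mul (c : ℂ) (hX : Lead N a X) : Lead N (c * a) fun z => c * X z := by
  simpa using (Lead.const c).mul hX

lemma sub (hX : Lead N a X) (hY : Lead N b Y) : Lead N (a - b) fun z => X z - Y z := by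
  have := hX.add (hY.const_mul (-1))
  simp only [neg_mul, one_mul, ← sub_eq_add_neg] at this
  exact this

lemma succ (hX : Lead N a X) : Lead (N + 1) 0 X := by
  obtain ⟨g, hg, hga, hgX⟩ := hX
  refine ⟨fun z => z * g z, analyticAt_id.mul hg, by simp, ?_⟩
  filter_upwards [hgX] with z h1
  rw [← h1]; ring

/-- Since `g 0 = 0`, the quotient `g z / z` extends analytically as `dslope g 0`. -/
lemma lower (hX : Lead (N + 1) 0 X) : ∃ b, Lead N b X := by
  obtain ⟨g, hg, hga, hgX⟩ := hX
  refine ⟨deriv g 0, dslope g 0, ?_, by simp, ?_⟩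
  · obtain ⟨p, hp⟩ := hg
    exact hp.has_fpower_series_dslope_fslope.analyticAt
  · filter_upwards [hgX, self_mem_nhdsWithin] with z h1 h2
    have h2 : z ≠ 0 := h2
    rw [dslope_of_ne _ h2, slope_def_field, ← h1, hga]
    field_simp
    ring

lemma deriv (hX : Lead N a X) : Lead (N + 1) (-N * a) (deriv X) := by
  obtain ⟨g, hg, hga, hgX⟩ := hX
  refine ⟨fun z => -N * g z + z * _root_.deriv g z, ?_, by simp [hga], ?_⟩
  · have := hg.deriv
    fun_prop
  · have hana := hg.eventually_analyticAt.filter_mono (nhdsWithin_le_nhds (s := {0}ᶜ))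
    have hev := eventually_eventually_nhdsWithin.mpr hgX
    filter_upwards [hev, hana, self_mem_nhdsWithin] with z h1 h2 h3
    have h3 : z ≠ 0 := h3
    rw [isOpen_compl_singleton.nhdsWithin_eq h3] at h1
    have hX' : X =ᶠ[𝓝 z] fun w => g w / w ^ N := by
      filter_upwards [h1, isOpen_ne.mem_nhds h3] with w hw hw0
      have hw0 : w ≠ 0 := hw0
      rw [← hw]; field_simp
    rw [hX'.deriv_eq]
    have hd : HasDerivAt (fun w => g w / w ^ N) _ z :=
      h2.differentiableAt.hasDerivAt.div (hasDerivAt_pow N z) (pow_ne_zero N h3)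
    rw [hd.deriv]
    rcases N with _ | N
    · simp
    · simp only [Nat.add_sub_cancel]
      field_simp
      ring

lemma comp_neg (hX : Lead N a X) : Lead N ((-1) ^ N * a) fun z => X (-z) := by
  obtain ⟨g, hg, hga, hgX⟩ := hX
  refine ⟨fun z => (-1) ^ N * g (-z), ?_, by simp [hga], ?_⟩
  · have : AnalyticAt ℂ (fun z : ℂ => g (-z)) 0 := by
      refine AnalyticAt.comp (g := g) (f := fun z : ℂ => -z) ?_ (by fun_prop)
      simpa using hg
    exact analyticAt_const.mul this
  · filter_upwards [tendsto_neg_punctured.eventually hgX] with z h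
    rw [← h, neg_pow z, ← mul_assoc, ← mul_assoc, ← mul_pow]; simp

lemma eventually_ne (hX : Lead N a X) (ha : a ≠ 0) : ∀ᶠ z in 𝓝[≠] (0 : ℂ), X z ≠ 0 := by
  obtain ⟨g, hg, hga, hgX⟩ := hX
  have h1 : ∀ᶠ z in 𝓝[≠] (0 : ℂ), g z ≠ 0 :=
    (hg.continuousAt.eventually_ne (hga ▸ ha)).filter_mono nhdsWithin_le_nhds
  filter_upwards [hgX, h1] with z h h' h0
  exact h' (by rw [← h, h0, mul_zero])

end Lead

namespace Jet

lemma const (c : ℂ) : Jet 0 c 0 fun _ => c := ⟨fun _ => 0, analyticAt_const, by simp⟩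

lemma add (hX : Jet N a b X) (hY : Jet N c d Y) : Jet N (a + c) (b + d) fun z => X z + Y z := by
  obtain ⟨g, hg, hgX⟩ := hX
  obtain ⟨k, hk, hkY⟩ := hY
  refine ⟨fun z => g z + k z, hg.add hk, ?_⟩
  filter_upwards [hgX, hkY] with z h1 h2
  rw [mul_add, h1, h2]; ring

lemma mul (hX : Jet N a b X) (hY : Jet M c d Y) :
    Jet (N + M) (a * c) (a * d + b * c) fun z => X z * Y z := by
  obtain ⟨g, hg, hgX⟩ := hX
  obtain ⟨k, hk, hkY⟩ := hY
  refine ⟨fun z => b * d + (a + b * z ^ 2) * k z + g z * (c + d * z ^ 2) + z ^ 4 * g z * k z,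
    by fun_prop, ?_⟩
  filter_upwards [hgX, hkY] with z h1 h2
  rw [show z ^ (N + M) * (X z * Y z) = (z ^ N * X z) * (z ^ M * Y z) by ring, h1, h2]
  ring

lemma const_mul (t : ℂ) (hX : Jet N a b X) : Jet N (t * a) (t * b) fun z => t * X z := by
  simpa using (Jet.const t).mul hX

lemma sub (hX : Jet N a b X) (hY : Jet N c d Y) : Jet N (a - c) (b - d) fun z => X z - Y z := by
  have := hX.add (hY.const_mul (-1))
  simp only [neg_mul, one_mul, ← sub_eq_add_neg] at this
  exact this

lemma add_two (hX : Jet N a b X) : Jet (N + 2) 0 a X := by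
  obtain ⟨g, hg, hgX⟩ := hX
  refine ⟨fun z => b + z ^ 2 * g z, by fun_prop, ?_⟩
  filter_upwards [hgX] with z h1
  rw [pow_add, mul_right_comm, h1]; ring

lemma lead (hX : Jet N a b X) : Lead N a X := by
  obtain ⟨g, hg, hgX⟩ := hX
  exact ⟨fun z => a + b * z ^ 2 + z ^ 4 * g z, by fun_prop, by simp, hgX⟩

lemma lead_of_zero (hX : Jet (N + 4) 0 0 X) : ∃ e, Lead N e X := by
  obtain ⟨g, hg, hgX⟩ := hX
  refine ⟨g 0, g, hg, rfl, ?_⟩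
  filter_upwards [hgX, self_mem_nhdsWithin] with z h1 h2
  have h2 : z ≠ 0 := h2
  refine mul_left_cancel₀ (pow_ne_zero 4 h2) ?_
  rw [← mul_assoc, ← pow_add, add_comm 4 N, h1]; ring

lemma deriv (hX : Jet N a b X) : Jet (N + 1) (-N * a) (-(N - 2) * b) (deriv X) := by
  obtain ⟨g, hg, hgX⟩ := hX
  -- The remainder comes from `(z^(4-N) g)' = z^(3-N) ((4 - N) g + z g')`.
  refine ⟨fun z => (4 - N) * g z + z * _root_.deriv g z, ?_, ?_⟩
  · have := hg.deriv
    fun_prop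
  · have hana := hg.eventually_analyticAt.filter_mono (nhdsWithin_le_nhds (s := {0}ᶜ))
    have hev := eventually_eventually_nhdsWithin.mpr hgX
    filter_upwards [hev, hana, self_mem_nhdsWithin] with z h1 h2 h3
    have h3 : z ≠ 0 := h3
    rw [isOpen_compl_singleton.nhdsWithin_eq h3] at h1
    have hX' : X =ᶠ[𝓝 z] fun w => (a + b * w ^ 2 + w ^ 4 * g w) / w ^ N := by
      filter_upwards [h1, isOpen_ne.mem_nhds h3] with w hw hw0
      have hw0 : w ≠ 0 := hw0
      rw [← hw]; field_simp
    rw [hX'.deriv_eq]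
    have hd : HasDerivAt (fun w => (a + b * w ^ 2 + w ^ 4 * g w) / w ^ N) _ z :=
      ((((hasDerivAt_pow 2 z).const_mul b).const_add a).add
        ((hasDerivAt_pow 4 z).mul h2.differentiableAt.hasDerivAt)).div
        (hasDerivAt_pow N z) (pow_ne_zero N h3)
    rw [hd.deriv]
    rcases N with _ | N
    · simp; ring
    · simp only [Nat.add_sub_cancel]
      field_simp
      push_cast
      simp
      ring

end Jet

end EllipticOP
end

/-! ### The functions `℘`, `℘'` and the basis of elliptic polynomials. -/

noncomputable section

namespace EllipticOP

open Filter Topology PeriodPair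

variable {L : PeriodPair} {X Y : ℂ → ℂ} {N M : ℕ} {a b c d : ℂ} {τ : UpperHalfPlane}

lemma Lead.pow (hX : Lead N a X) (k : ℕ) : Lead (N * k) (a ^ k) fun z => X z ^ k := by
  induction k with
  | zero => simpa using Lead.const 1
  | succ k ih => simpa [pow_succ, mul_add] using ih.mul hX

lemma exists_eq_add_mul {g : ℂ → ℂ} (hg : AnalyticAt ℂ g 0) :
    ∃ k : ℂ → ℂ, AnalyticAt ℂ k 0 ∧ k 0 = deriv g 0 ∧ ∀ z, g z = g 0 + z * k z := by
  refine ⟨dslope g 0, ?_, by simp, fun z => ?_⟩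
  · obtain ⟨p, hp⟩ := hg
    exact hp.has_fpower_series_dslope_fslope.analyticAt
  · have := sub_smul_dslope g 0 z
    rw [sub_zero, smul_eq_mul] at this
    rw [this]; ring

lemma add_coe_of_periodic (h₁ : Function.Periodic X L.ω₁) (h₂ : Function.Periodic X L.ω₂) :
    ∀ l ∈ L.lattice, ∀ z, X (z + l) = X z := by
  intro l hl z
  obtain ⟨m, n, rfl⟩ := mem_lattice.mp hl
  exact ((h₁.int_mul m).add_period (h₂.int_mul n)) z

lemma isElliptic_wp (τ : UpperHalfPlane) : IsElliptic (periods τ) (wp τ) :=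
  ⟨fun l hl z => (periods τ).weierstrassP_add_coe z ⟨l, hl⟩, (periods τ).differentiableOn_weierstrassP⟩

lemma deriv_wp (τ : UpperHalfPlane) : deriv (wp τ) = wp' τ := (periods τ).deriv_weierstrassP

lemma isElliptic_wp' (τ : UpperHalfPlane) : IsElliptic (periods τ) (wp' τ) :=
  deriv_wp τ ▸ (isElliptic_wp τ).deriv

/-- The regular part `℘ - 1/z²` vanishes at `0` together with its first derivative, so it is `z²`
times an analytic function. -/
lemma jet_wp (τ : UpperHalfPlane) : Jet 2 1 0 (wp τ) := by
  have hana := (periods τ).analyticAt_weierstrassPExcept 0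
  obtain ⟨k, hk, hk0, hgk⟩ := exists_eq_add_mul hana
  obtain ⟨k', hk', -, hgk'⟩ := exists_eq_add_mul hk
  rw [deriv_weierstrassPExcept_same, derivWeierstrassPExcept_zero_zero] at hk0
  refine ⟨k', hk', ?_⟩
  filter_upwards [self_mem_nhdsWithin] with z hz
  have hz : z ≠ 0 := hz
  have h := (periods τ).weierstrassPExcept_add 0 z
  rw [ZeroMemClass.coe_zero, hgk, weierstrassPExcept_zero, hgk', hk0] at h
  rw [wp, ← h, sub_zero, zero_add, zero_add]
  simp
  field_simp
  ring

lemma jet_wp' (τ : UpperHalfPlane) : Jet 3 (-2) 0 (wp' τ) := by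
  simpa [deriv_wp] using (jet_wp τ).deriv

lemma wp_neg (τ : UpperHalfPlane) (z : ℂ) : wp τ (-z) = wp τ z := (periods τ).weierstrassP_neg z

lemma wp'_neg (τ : UpperHalfPlane) (z : ℂ) : wp' τ (-z) = -wp' τ z :=
  (periods τ).derivWeierstrassP_neg z

lemma isElliptic_basisFun (τ : UpperHalfPlane) (k : ℕ) :
    IsElliptic (periods τ) (basisFun τ k) := by
  unfold basisFun
  split_ifs
  · exact (isElliptic_wp τ).pow _
  · exact ((isElliptic_wp' τ).const_mul _).mul ((isElliptic_wp τ).pow _)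

lemma lead_basisFun (τ : UpperHalfPlane) {k : ℕ} (hk : k ≠ 1) : Lead k 1 (basisFun τ k) := by
  unfold basisFun
  split_ifs with h
  · simpa [Nat.mul_div_cancel' h.two_dvd] using (jet_wp τ).lead.pow (k / 2)
  · rw [Nat.not_even_iff_odd] at h
    obtain ⟨j, rfl⟩ := h
    obtain ⟨i, rfl⟩ : ∃ i, j = i + 1 := ⟨j - 1, by omega⟩
    have h1 := ((jet_wp' τ).lead.const_mul (-(1 / 2))).mul ((jet_wp τ).lead.pow i)
    rw [show (2 * (i + 1) + 1 - 3) / 2 = i by omega, show 2 * (i + 1) + 1 = 3 + 2 * i by ring]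
    simpa using h1

lemma basisFun_neg (τ : UpperHalfPlane) (k : ℕ) (z : ℂ) :
    basisFun τ k (-z) = (-1) ^ k * basisFun τ k z := by
  unfold basisFun
  split_ifs with h
  · simp [wp_neg, h.neg_one_pow]
  · rw [Nat.not_even_iff_odd] at h
    simp [wp_neg, wp'_neg, h.neg_one_pow]

/-- The pair of periods `(1/2, τ)`. -/
def halfPeriods (τ : UpperHalfPlane) : PeriodPair where
  ω₁ := 1 / 2
  ω₂ := (τ : ℂ)
  indep := by
    rw [LinearIndependent.pair_iff]
    intro s t h
    have him := congrArg Complex.im h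
    have ht : t = 0 := by
      simpa [τ.im_ne_zero] using him
    subst ht
    have hre := congrArg Complex.re h
    exact ⟨by simpa using hre, rfl⟩

lemma one_mem_lattice (τ : UpperHalfPlane) : (1 : ℂ) ∈ (periods τ).lattice :=
  (periods τ).ω₁_mem_lattice

lemma tau_mem_lattice (τ : UpperHalfPlane) : (τ : ℂ) ∈ (periods τ).lattice :=
  (periods τ).ω₂_mem_lattice

lemma countable_lattice (L : PeriodPair) : (L.lattice : Set ℂ).Countable := by
  have : Countable L.lattice := L.latticeEquivProd.toEquiv.countable_iff.mpr inferInstance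
  exact Set.countable_coe_iff.mp this

lemma lattice_le_halfPeriods (τ : UpperHalfPlane) :
    (periods τ).lattice ≤ (halfPeriods τ).lattice := by
  refine Submodule.span_le.mpr ?_
  rintro x (rfl | rfl)
  · have := add_mem (halfPeriods τ).ω₁_mem_lattice (halfPeriods τ).ω₁_mem_lattice
    convert! this using 1
    simp [halfPeriods, periods]
    norm_num
  · exact (halfPeriods τ).ω₂_mem_lattice

/-- There is no elliptic function with a single simple pole. -/
lemma lead_one_eq_zero (hX : IsElliptic (periods τ) X) (h : Lead 1 a X) : a = 0 := by
  by_contra ha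
  set p : ℂ → ℂ := fun z => X z - X (-z) with hp
  have hpe : IsElliptic (periods τ) p := hX.sub hX.comp_neg
  have hpl : Lead 1 (2 * a) p := by
    have := h.sub h.comp_neg
    simp only [pow_one, neg_mul, one_mul, sub_neg_eq_add, ← two_mul] at this
    exact this
  have hodd : ∀ z, p (-z) = -p z := fun z => by simp [hp]
  -- An odd elliptic function vanishes at every half-period that is not a pole; at lattice points
  -- the same computation constrains only the assigned value.
  have hhalf : ∀ w, w + w ∈ (periods τ).lattice → p w = 0 := fun w hw => by
    have h1 := hpe.add_coe _ hw (-w)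
    rw [neg_add_cancel_left, hodd] at h1
    exact self_eq_neg.mp h1
  have hhm : (1 / 2 : ℂ) ∉ (periods τ).lattice := (periods τ).ω₁_div_two_notMem_lattice
  -- Modulo the finer lattice of `1/2` and `τ`, the only possible pole of `F` is `0`, and there the
  -- zero of `p` at `1/2` cancels it. So `F` is constant, and its value at `τ/2` is `0`. As `p ≠ 0`
  -- near `0`, `p` must vanish near `1/2`, hence identically, which contradicts its residue `2a`.
  set F : ℂ → ℂ := fun z => p z * p (z + 1 / 2) with hF
  have hFe : IsElliptic (halfPeriods τ) F := by
    refine ⟨add_coe_of_periodic (fun z => ?_) (fun z => ?_), ?_⟩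
    · change p (z + 1 / 2) * p (z + 1 / 2 + 1 / 2) = p z * p (z + 1 / 2)
      rw [add_assoc, add_halves, hpe.add_coe _ (one_mem_lattice τ), mul_comm]
    · change p (z + τ) * p (z + τ + 1 / 2) = p z * p (z + 1 / 2)
      rw [add_right_comm, hpe.add_coe _ (tau_mem_lattice τ), hpe.add_coe _ (tau_mem_lattice τ)]
    · refine (hpe.diff.mono ?_).mul (hpe.diff.comp (by fun_prop) ?_)
      · exact Set.compl_subset_compl.mpr (lattice_le_halfPeriods τ)
      · intro z hz hz'
        refine hz ?_
        have h1 := sub_mem (lattice_le_halfPeriods τ hz') (halfPeriods τ).ω₁_mem_lattice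
        convert! h1 using 1
        simp [halfPeriods]
  have hq : Lead 0 0 fun z => p (z + 1 / 2) := by
    refine ⟨fun z => p (z + 1 / 2), ?_, ?_, by simp⟩
    · have : AnalyticAt ℂ p (1 / 2) :=
        hpe.diff.analyticAt ((periods τ).isClosed_lattice.isOpen_compl.mem_nhds hhm)
      refine AnalyticAt.comp (g := p) (f := fun z : ℂ => z + 1 / 2) ?_ (by fun_prop)
      simpa using this
    · change p (0 + 1 / 2) = 0
      rw [zero_add]
      exact hhalf _ (by rw [add_halves]; exact one_mem_lattice τ)
  have hFl : Lead (0 + 1) 0 F := by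
    have := hpl.mul hq
    rw [mul_zero] at this
    exact this
  obtain ⟨e, he⟩ := hFl.lower
  have he0 : e = 0 := by
    rw [← hFe.eq_const he (halfPeriods τ).ω₂_div_two_notMem_lattice]
    simp only [hF]
    rw [hhalf, zero_mul]
    convert! tau_mem_lattice τ using 1
    simp [halfPeriods]
  have hne := hpl.eventually_ne (mul_ne_zero two_ne_zero ha)
  have hq0 : ∀ᶠ z in 𝓝[≠] (0 : ℂ), p (z + 1 / 2) = 0 := by
    filter_upwards [hne, notMem_lattice_of_near_zero (halfPeriods τ)] with z h1 h2
    have h3 := hFe.eq_const he h2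
    rw [he0] at h3
    exact (mul_eq_zero.mp h3).resolve_left h1
  have hp0 : ∀ᶠ z in 𝓝[≠] (1 / 2 : ℂ), p z = 0 := by
    have ht : Tendsto (fun z : ℂ => z - 1 / 2) (𝓝[≠] (1 / 2)) (𝓝[≠] 0) := by
      refine tendsto_nhdsWithin_iff.mpr ⟨?_, ?_⟩
      · have : ContinuousAt (fun z : ℂ => z - 1 / 2) (1 / 2) := by fun_prop
        simpa [ContinuousAt] using this.tendsto.mono_left nhdsWithin_le_nhds
      · filter_upwards [self_mem_nhdsWithin] with z hz
        simpa [sub_eq_zero] using hz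
    filter_upwards [ht.eventually hq0] with z hz
    simpa using hz
  have hconn : IsPreconnected ((periods τ).lattice : Set ℂ)ᶜ :=
    ((countable_lattice _).isConnected_compl_of_one_lt_rank
      (by rw [Complex.rank_real_complex]; norm_num)).isPreconnected
  have hzero := (hpe.diff.analyticOnNhd
    (periods τ).isClosed_lattice.isOpen_compl).eqOn_zero_of_preconnected_of_frequently_eq_zero
    hconn hhm hp0.frequently
  obtain ⟨z, h1, h2⟩ := (hne.and (notMem_lattice_of_near_zero (periods τ))).exists
  exact h1 (hzero h2)

/-- Elliptic polynomials of degree less than `m + 2` are combinations of the basis elements. -/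
lemma exists_eq_sum_basisFun (m : ℕ) (hX : IsElliptic (periods τ) X) (h : Lead (m + 1) a X) :
    ∃ c : Fin (m + 1) → ℂ, ∀ z ∉ (periods τ).lattice,
      X z = ∑ i, c i * basisFun τ (skipOne i) z := by
  induction m generalizing X a with
  | zero =>
    -- The gap at index `1` in the basis is the absence of elliptic functions with one simple pole.
    rw [lead_one_eq_zero hX h] at h
    obtain ⟨b, hb⟩ := Lead.lower h
    refine ⟨fun _ => b, fun z hz => ?_⟩
    simp [hX.eq_const hb hz, skipOne, basisFun]
  | succ m ih =>
    have hE := lead_basisFun τ (k := m + 2) (by omega)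
    have h1 : Lead (m + 1 + 1) 0 fun z => X z - a * basisFun τ (m + 2) z := by
      simpa using h.sub (hE.const_mul a)
    obtain ⟨b, hb⟩ := h1.lower
    obtain ⟨c, hc⟩ := ih (hX.sub ((isElliptic_basisFun τ _).const_mul a)) hb
    refine ⟨Fin.snoc c a, fun z hz => ?_⟩
    rw [Fin.sum_univ_castSucc]
    simp only [Fin.snoc_castSucc, Fin.snoc_last, Fin.val_castSucc, Fin.val_last]
    rw [← hc z hz]
    simp [skipOne]

/-! ### Integration over `γ` and the bilinear form. -/

lemma gamma_notMem (τ : UpperHalfPlane) (x : ℝ) : (τ : ℂ) / 2 + x ∉ (periods τ).lattice := by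
  intro h
  obtain ⟨m, n, h⟩ := mem_lattice.mp h
  have him := congrArg Complex.im h
  simp only [periods, mul_one, Complex.add_im, Complex.intCast_im, zero_add, Complex.mul_im,
    Complex.intCast_re, zero_mul, add_zero, Complex.ofReal_im, UpperHalfPlane.coe_im] at him
  have h2 : ((τ : ℂ) / 2).im = τ.im / 2 := by simp
  rw [h2] at him
  have h3 : ((2 * n - 1 : ℤ) : ℝ) * τ.im = 0 := by push_cast; linarith
  rcases mul_eq_zero.mp h3 with h4 | h4
  · have : (2 * n - 1 : ℤ) = 0 := by exact_mod_cast h4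
    omega
  · exact τ.im_ne_zero h4

lemma continuous_gamma (hX : IsElliptic (periods τ) X) :
    Continuous fun x : ℝ => X ((τ : ℂ) / 2 + x) :=
  hX.diff.continuousOn.comp_continuous (by fun_prop) fun x => gamma_notMem τ x

lemma gammaInt_congr (h : ∀ z ∉ (periods τ).lattice, X z = Y z) : gammaInt τ X = gammaInt τ Y :=
  intervalIntegral.integral_congr fun x _ => h _ (gamma_notMem τ x)

lemma gammaInt_add (hX : IsElliptic (periods τ) X) (hY : IsElliptic (periods τ) Y) :
    gammaInt τ (fun z => X z + Y z) = gammaInt τ X + gammaInt τ Y :=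
  intervalIntegral.integral_add ((continuous_gamma hX).intervalIntegrable _ _)
    ((continuous_gamma hY).intervalIntegrable _ _)

lemma gammaInt_const_mul (c : ℂ) (X : ℂ → ℂ) :
    gammaInt τ (fun z => c * X z) = c * gammaInt τ X :=
  intervalIntegral.integral_const_mul _ _

lemma gammaInt_sum {ι : Type*} (s : Finset ι) {F : ι → ℂ → ℂ}
    (h : ∀ i ∈ s, IsElliptic (periods τ) (F i)) :
    gammaInt τ (fun z => ∑ i ∈ s, F i z) = ∑ i ∈ s, gammaInt τ (F i) :=
  intervalIntegral.integral_finsetSum fun i hi => (continuous_gamma (h i hi)).intervalIntegrable _ _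

/-- The endpoints of `γ` differ by the period `1`; this is what removes boundary terms in
`pairing_deriv`. -/
lemma gammaInt_deriv (hX : IsElliptic (periods τ) X) : gammaInt τ (deriv X) = 0 := by
  have h : ∀ x : ℝ, HasDerivAt (fun x : ℝ => X ((τ : ℂ) / 2 + x)) (deriv X ((τ : ℂ) / 2 + x)) x := by
    intro x
    have h1 := (hX.differentiableAt (gamma_notMem τ x)).hasDerivAt
    have h2 : HasDerivAt (fun w : ℂ => X ((τ : ℂ) / 2 + w)) (deriv X ((τ : ℂ) / 2 + x)) (x : ℂ) :=
      h1.comp_const_add _ _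
    exact h2.comp_ofReal
  unfold gammaInt
  rw [intervalIntegral.integral_eq_sub_of_hasDerivAt (fun x _ => h x)
    ((continuous_gamma hX.deriv).intervalIntegrable _ _)]
  have := hX.add_coe _ (one_mem_lattice τ) ((τ : ℂ) / 2)
  simp [this]

/-- Translation by the period `1 + τ` carries `-γ` back to `γ`, with `x` replaced by `1 - x`. -/
lemma gammaInt_comp_neg (hX : IsElliptic (periods τ) X) :
    gammaInt τ (fun z => X (-z)) = gammaInt τ X := by
  have h : ∀ x : ℝ, X (-((τ : ℂ) / 2 + x)) = X ((τ : ℂ) / 2 + ((1 - x : ℝ) : ℂ)) := fun x => by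
    rw [← hX.add_coe _ (one_mem_lattice τ), ← hX.add_coe _ (tau_mem_lattice τ)]
    congr 1; push_cast; ring
  unfold gammaInt
  simp only [h]
  rw [intervalIntegral.integral_comp_sub_left (fun x : ℝ => X ((τ : ℂ) / 2 + (x : ℂ))) 1]
  simp

lemma gammaInt_odd (hX : IsElliptic (periods τ) X)
    (h : ∀ z ∉ (periods τ).lattice, X (-z) = -X z) : gammaInt τ X = 0 := by
  have h1 := gammaInt_comp_neg hX
  rw [gammaInt_congr (Y := fun z => (-1) * X z) (fun z hz => by rw [h z hz]; ring),
    gammaInt_const_mul, neg_one_mul] at h1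
  exact self_eq_neg.mp h1.symm

/-- The bilinear form `∫_γ X Y dz`. -/
def pairing (τ : UpperHalfPlane) (X Y : ℂ → ℂ) : ℂ := gammaInt τ fun z => X z * Y z

lemma pairing_comm (X Y : ℂ → ℂ) : pairing τ X Y = pairing τ Y X := by
  simp only [pairing, mul_comm]

lemma pairing_deriv (hX : IsElliptic (periods τ) X) (hY : IsElliptic (periods τ) Y) :
    pairing τ (deriv X) Y = -pairing τ X (deriv Y) := by
  have h := gammaInt_deriv (hX.mul hY)
  rw [gammaInt_congr (Y := fun z => deriv X z * Y z + X z * deriv Y z) (fun z hz =>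
    deriv_fun_mul (hX.differentiableAt hz) (hY.differentiableAt hz)),
    gammaInt_add (hX.deriv.mul hY) (hX.mul hY.deriv)] at h
  exact eq_neg_of_add_eq_zero_left h

lemma pairing_eq_zero_of_lead {m : ℕ} {p : ℂ → ℂ} (hp : IsElliptic (periods τ) p)
    (h : ∀ k, k < m + 2 → k ≠ 1 → pairing τ p (basisFun τ k) = 0)
    (hX : IsElliptic (periods τ) X) (hl : Lead (m + 1) a X) : pairing τ p X = 0 := by
  obtain ⟨c, hc⟩ := exists_eq_sum_basisFun m hX hl
  unfold pairing
  rw [gammaInt_congr (Y := fun z => ∑ i : Fin (m + 1), c i * (p z * basisFun τ (skipOne i) z))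
    (fun z hz => by rw [hc z hz, Finset.mul_sum]; exact Finset.sum_congr rfl fun i _ => by ring),
    gammaInt_sum _ fun i _ => (hp.mul (isElliptic_basisFun τ _)).const_mul _]
  refine Finset.sum_eq_zero fun i _ => ?_
  rw [gammaInt_const_mul]
  have := h (skipOne i) (by unfold skipOne; split_ifs <;> omega) (by unfold skipOne; split_ifs <;> omega)
  rw [pairing] at this
  rw [this, mul_zero]

/-- The coefficient vector of `X` in the basis lies in the kernel of the moment matrix with indices
`0, 2, …, m + 1`, whose determinant is `D_{m+2}`. -/
lemma eq_zero_of_orthogonal {m : ℕ} (hD : momentDet τ (m + 2) ≠ 0)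
    (hX : IsElliptic (periods τ) X) (hl : Lead (m + 1) a X)
    (h : ∀ k, k < m + 2 → k ≠ 1 → pairing τ X (basisFun τ k) = 0) :
    ∀ z ∉ (periods τ).lattice, X z = 0 := by
  obtain ⟨c, hc⟩ := exists_eq_sum_basisFun m hX hl
  have hc0 : c = 0 := by
    refine Matrix.eq_zero_of_mulVec_eq_zero
      (M := Matrix.of fun i j : Fin (m + 1) => moment τ (skipOne i) (skipOne j)) hD ?_
    funext j
    have := h (skipOne j) (by unfold skipOne; split_ifs <;> omega) (by unfold skipOne; split_ifs <;> omega)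
    unfold pairing at this
    rw [gammaInt_congr (Y := fun z => ∑ i : Fin (m + 1),
      c i * (basisFun τ (skipOne j) z * basisFun τ (skipOne i) z))
      (fun z hz => by rw [hc z hz, Finset.sum_mul]; exact Finset.sum_congr rfl fun i _ => by ring),
      gammaInt_sum _ fun i _ => ((isElliptic_basisFun τ _).mul (isElliptic_basisFun τ _)).const_mul _]
      at this
    simp only [gammaInt_const_mul] at this
    simp only [Matrix.mulVec, dotProduct, Matrix.of_apply, moment, Pi.zero_apply]
    rw [← this]
    exact Finset.sum_congr rfl fun i _ => mul_comm _ _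
  intro z hz
  rw [hc z hz, hc0]
  simp

end EllipticOP
end

/-! ### The three-term relation and the differential relation. -/

noncomputable section

namespace EllipticOP

open Filter Topology PeriodPair

variable {X Y Z : ℂ → ℂ} {N M : ℕ} {a b c d : ℂ} {τ : UpperHalfPlane}

lemma Lead.cast (h : Lead N a X) (hN : N = M) (ha : a = b) : Lead M b X := by
  subst hN ha; exact h

lemma Jet.cast (h : Jet N a b X) (hN : N = M) (ha : a = c) (hb : b = d) : Jet M c d X := by
  subst hN ha hb; exact h

lemma pairing_add_left (hX : IsElliptic (periods τ) X) (hY : IsElliptic (periods τ) Y)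
    (hZ : IsElliptic (periods τ) Z) :
    pairing τ (fun z => X z + Y z) Z = pairing τ X Z + pairing τ Y Z := by
  simp only [pairing, add_mul]
  exact gammaInt_add (hX.mul hZ) (hY.mul hZ)

lemma pairing_const_mul_left (c : ℂ) (X Y : ℂ → ℂ) :
    pairing τ (fun z => c * X z) Y = c * pairing τ X Y := by
  simp only [pairing, mul_assoc]
  exact gammaInt_const_mul c _

lemma pairing_mul_left (X Y Z : ℂ → ℂ) :
    pairing τ (fun z => X z * Y z) Z = pairing τ Y (fun z => X z * Z z) := by
  simp only [pairing, mul_assoc, mul_left_comm]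

/-- The properties of a monic orthogonal elliptic polynomial `p` of degree `m` on which the
recurrences rest: `c` is its second coefficient and `h` its squared norm. -/
structure OrthPoly (τ : UpperHalfPlane) (m : ℕ) (p : ℂ → ℂ) (c h : ℂ) : Prop where
  ell : IsElliptic (periods τ) p
  jet : Jet m 1 c p
  neg : ∀ z ∉ (periods τ).lattice, p (-z) = (-1) ^ m * p z
  pairing_lead : ∀ (Y : ℂ → ℂ) (a : ℂ), IsElliptic (periods τ) Y → Lead m a Y →
    pairing τ p Y = a * h

/-- `t` is the second coefficient of the Cauchy transform of `p`. -/
def HasTail (τ : UpperHalfPlane) (m : ℕ) (p : ℂ → ℂ) (t h : ℂ) : Prop :=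
  ∀ (Y : ℂ → ℂ) (a b : ℂ), IsElliptic (periods τ) Y → Jet (m + 2) a b Y →
    pairing τ p Y = h * (a * t + b)

variable {m j : ℕ} {p p₀ p₁ p₂ : ℂ → ℂ} {c₀ c₁ c₂ h h₀ h₁ h₂ t₀ t₁ : ℂ}

lemma OrthPoly.pairing_eq_zero (hp : OrthPoly τ (m + 1) p c h) (hY : IsElliptic (periods τ) Y)
    (hl : Lead m a Y) : pairing τ p Y = 0 := by
  rw [hp.pairing_lead Y 0 hY hl.succ, zero_mul]

/-- The relation between consecutive norms obtained from `⟨p₁', p₀⟩`. -/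
lemma OrthPoly.norm_relation (H₀ : OrthPoly τ m p₀ c₀ h₀) (H₁ : OrthPoly τ (m + 1) p₁ c₁ h₁)
    (T₀ : HasTail τ m p₀ t₀ h₀) :
    m * h₁ = h₀ * (-(m + 1) * t₀ - (m - 1) * c₁) := by
  have e1 := pairing_deriv H₁.ell H₀.ell
  rw [H₁.pairing_lead _ _ H₀.ell.deriv H₀.jet.lead.deriv, pairing_comm,
    T₀ _ _ _ H₁.ell.deriv H₁.jet.deriv] at e1
  push_cast at e1
  linear_combination -e1

/-- `⟨p₀, p₂⟩` is `0` by orthogonality of `p₂`, and `h₀ (t₀ + c₂)` by the tail of `p₀`. -/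
lemma OrthPoly.coeff_eq_neg_tail (H₂ : OrthPoly τ (m + 2) p₂ c₂ h₂)
    (H₀ : OrthPoly τ m p₀ c₀ h₀) (T₀ : HasTail τ m p₀ t₀ h₀) (hh : h₀ ≠ 0) : c₂ = -t₀ := by
  have e1 := T₀ _ _ _ H₂.ell H₂.jet
  rw [pairing_comm, OrthPoly.pairing_eq_zero (m := m + 1) H₂ H₀.ell H₀.jet.lead.succ] at e1
  have := (mul_eq_zero.mp e1.symm).resolve_left hh
  linear_combination this

/-- The criterion behind both relations. The vanishing jet leaves degree at most `j + 2`. Degrees up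
to `j` are covered by `h1`, degree `j + 1` by parity, and degree `j + 2` by `p₀`, which agrees with
the basis element up to lower degree. -/
lemma eq_zero_of_pairing (hD : momentDet τ (j + 3) ≠ 0) (H₀ : OrthPoly τ (j + 2) p₀ c₀ h₀)
    (hX : IsElliptic (periods τ) X) (hneg : ∀ z ∉ (periods τ).lattice, X (-z) = (-1) ^ j * X z)
    (hjet : Jet (j + 6) 0 0 X)
    (h1 : ∀ Y y, IsElliptic (periods τ) Y → Lead j y Y → pairing τ X Y = 0)
    (h2 : pairing τ X p₀ = 0) : ∀ z ∉ (periods τ).lattice, X z = 0 := by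
  obtain ⟨e, he⟩ := Jet.lead_of_zero (N := j + 2) hjet
  have hlow : ∀ k, k < j + 2 → k ≠ 1 → pairing τ X (basisFun τ k) = 0 := by
    intro k hk hk1
    rcases Nat.lt_succ_iff_lt_or_eq.mp hk with hk | rfl
    · refine h1 _ (if k = j then 1 else 0) (isElliptic_basisFun τ k) ?_
      have hl := lead_basisFun τ hk1
      split_ifs with hkj
      · exact hl.cast hkj rfl
      · have : ∀ i, Lead (k + 1 + i) 0 (basisFun τ k) := fun i => by
          induction i with
          | zero => exact hl.succ
          | succ i ih => exact ih.succ
        exact (this (j - (k + 1))).cast (by omega) rfl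
    · refine gammaInt_odd (hX.mul (isElliptic_basisFun τ _)) fun z hz => ?_
      rw [hneg z hz, basisFun_neg, pow_succ]
      have : ((-1 : ℂ) ^ j) * (-1) ^ j = 1 := by rw [← mul_pow]; simp
      linear_combination (-X z * basisFun τ (j + 1) z) * this
  refine eq_zero_of_orthogonal (m := j + 1) hD hX he fun k hk hk1 => ?_
  rcases Nat.lt_succ_iff_lt_or_eq.mp hk with hk | rfl
  · exact hlow k hk hk1
  · have hE := lead_basisFun τ hk1
    have hd : Lead (j + 1 + 1) 0 fun z => basisFun τ (j + 2) z - p₀ z := by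
      simpa using hE.sub H₀.jet.lead
    obtain ⟨b, hb⟩ := hd.lower
    have e0 := pairing_eq_zero_of_lead hX hlow ((isElliptic_basisFun τ _).sub H₀.ell) hb
    have e1 := pairing_add_left ((isElliptic_basisFun τ (j + 2)).sub H₀.ell) H₀.ell hX
    simp only [sub_add_cancel] at e1
    rw [pairing_comm, e1, pairing_comm, e0, pairing_comm, h2, add_zero]

/-- The three-term relation between `p₀`, `p₁`, `p₂`. -/
theorem OrthPoly.three_term (H₀ : OrthPoly τ (j + 2) p₀ c₀ h₀) (H₁ : OrthPoly τ (j + 3) p₁ c₁ h₁)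
    (H₂ : OrthPoly τ (j + 4) p₂ c₂ h₂) (T₀ : HasTail τ (j + 2) p₀ t₀ h₀)
    (T₁ : HasTail τ (j + 3) p₁ t₁ h₁) (hD : momentDet τ (j + 3) ≠ 0) (n₀ : h₀ ≠ 0) (n₁ : h₁ ≠ 0)
    {α α' : ℂ} (hα : α = c₁ + t₀ - h₁ / h₀) (hα' : α' = c₂ + t₁ - h₂ / h₁) :
    ∀ z ∉ (periods τ).lattice, (wp τ z + α) * p₂ z + wp' τ z / 2 * p₁ z
      + h₁ / h₀ * (wp τ z + α') * p₀ z = 0 := by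
  have S := OrthPoly.coeff_eq_neg_tail (m := j + 2) H₂ H₀ T₀ n₀
  have E := isElliptic_wp τ
  have E' := isElliptic_wp' τ
  have K := jet_wp τ
  have K' := jet_wp' τ
  set β := h₁ / h₀ with hβ
  have hβ0 : β * h₀ = h₁ := div_mul_cancel₀ _ n₀
  have e1 := E.mul H₂.ell
  have e2 := H₂.ell.const_mul α
  have e3 := (E'.mul H₁.ell).const_mul (1 / 2)
  have e4 := (E.mul H₀.ell).const_mul β
  have e5 := H₀.ell.const_mul (β * α')
  have key : ∀ Y, IsElliptic (periods τ) Y →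
      pairing τ (fun z => wp τ z * p₂ z + α * p₂ z + 1 / 2 * (wp' τ z * p₁ z)
        + β * (wp τ z * p₀ z) + β * α' * p₀ z) Y =
      pairing τ p₂ (fun z => wp τ z * Y z) + α * pairing τ p₂ Y
        + 1 / 2 * pairing τ p₁ (fun z => wp' τ z * Y z) + β * pairing τ p₀ (fun z => wp τ z * Y z)
        + β * α' * pairing τ p₀ Y := by
    intro Y hY
    rw [pairing_add_left (((e1.add e2).add e3).add e4) e5 hY,
      pairing_add_left ((e1.add e2).add e3) e4 hY, pairing_add_left (e1.add e2) e3 hY,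
      pairing_add_left e1 e2 hY]
    simp only [pairing_const_mul_left, pairing_mul_left]
  have hzero := eq_zero_of_pairing hD H₀ ((((e1.add e2).add e3).add e4).add e5) ?_ ?_ ?_ ?_
  · intro z hz
    have := hzero z hz
    linear_combination this
  · intro z hz
    simp only [wp_neg, wp'_neg, H₀.neg z hz, H₁.neg z hz, H₂.neg z hz]
    ring
  · have q1 := (K.mul H₂.jet).cast (M := j + 6) (by ring) rfl rfl
    have q2 := (H₂.jet.const_mul α).add_two.cast (M := j + 6) (by ring) rfl rfl
    have q3 := ((K'.mul H₁.jet).const_mul (1 / 2)).cast (M := j + 6) (by ring) rfl rfl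
    have q4 := ((K.mul H₀.jet).const_mul β).add_two.cast (M := j + 6) (by ring) rfl rfl
    have q5 := (H₀.jet.const_mul (β * α')).add_two.add_two.cast (M := j + 6) (by ring) rfl rfl
    refine ((((q1.add q2).add q3).add q4).add q5).cast rfl ?_ ?_
    · ring
    -- The second coefficient is `c₂ + α - c₁ + β`; with `c₂ = -t₀` it vanishes precisely for the
    -- given `α`.
    · rw [hα, S]; ring
  · intro Y y hY hl
    rw [key Y hY]
    have l1 := ((K.lead.mul hl).succ.succ).cast (M := j + 4) (by ring) rfl
    have l2 := hl.succ.succ.succ.succ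
    have l3 := (K'.lead.mul hl).cast (M := j + 3) (by ring) rfl
    have l4 := (K.lead.mul hl).cast (M := j + 2) (by ring) rfl
    have l5 := hl.succ.succ
    rw [H₂.pairing_lead _ _ (E.mul hY) l1, H₂.pairing_lead _ _ hY l2,
      H₁.pairing_lead _ _ (E'.mul hY) l3, H₀.pairing_lead _ _ (E.mul hY) l4,
      H₀.pairing_lead _ _ hY l5]
    -- The surviving terms are `-y h₁` from `℘' p₁ / 2` and `y β h₀` from `β ℘ p₀`; this forces `β =
    -- h₁ / h₀`.
    linear_combination y * hβ0
  -- Pairing with `p₀` involves the tails of `p₀` and `p₁`, and it is this condition that determines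
  -- `α'`.
  · rw [key _ H₀.ell]
    have l1 := (K.lead.mul H₀.jet.lead).cast (M := j + 4) (by ring) rfl
    have l2 := H₀.jet.lead.succ.succ
    have l3 := (K'.mul H₀.jet).cast (M := j + 3 + 2) (by ring) rfl rfl
    have l4 := (K.mul H₀.jet).cast (M := j + 2 + 2) (by ring) rfl rfl
    rw [H₂.pairing_lead _ _ (E.mul H₀.ell) l1, H₂.pairing_lead _ _ H₀.ell l2,
      T₁ _ _ _ (E'.mul H₀.ell) l3, T₀ _ _ _ (E.mul H₀.ell) l4,
      H₀.pairing_lead _ _ H₀.ell H₀.jet.lead, hα', S]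
    have hβ1 : h₂ / h₁ * h₁ = h₂ := div_mul_cancel₀ _ n₁
    linear_combination (c₀ + t₁ - h₂ / h₁) * hβ0 - hβ1

/-- The first order differential relation between `p₁` and `p₀`. -/
theorem OrthPoly.deriv_relation (H₀ : OrthPoly τ (j + 2) p₀ c₀ h₀)
    (H₁ : OrthPoly τ (j + 3) p₁ c₁ h₁)
    (H₂ : OrthPoly τ (j + 4) p₂ c₂ h₂) (T₀ : HasTail τ (j + 2) p₀ t₀ h₀)
    (T₁ : HasTail τ (j + 3) p₁ t₁ h₁) (hD : momentDet τ (j + 3) ≠ 0) (n₀ : h₀ ≠ 0) (n₁ : h₁ ≠ 0)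
    {α α' : ℂ} (hα : α = c₁ + t₀ - h₁ / h₀) (hα' : α' = c₂ + t₁ - h₂ / h₁) :
    ∀ z ∉ (periods τ).lattice, (wp τ z + α) * deriv p₁ z =
      (j + 3) * wp' τ z / 2 * p₁ z
      + h₁ / h₀ * ((j + 2) * (wp τ z + α) + (j + 3) * (wp τ z + α')) * p₀ z := by
  have S := OrthPoly.coeff_eq_neg_tail (m := j + 2) H₂ H₀ T₀ n₀
  have R₀ := OrthPoly.norm_relation (m := j + 2) H₀ H₁ T₀
  have R₁ := OrthPoly.norm_relation (m := j + 3) H₁ H₂ T₁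
  push_cast at R₀ R₁
  have E := isElliptic_wp τ
  have E' := isElliptic_wp' τ
  have K := jet_wp τ
  have K' := jet_wp' τ
  set β := h₁ / h₀ with hβ
  have hβ0 : β * h₀ = h₁ := div_mul_cancel₀ _ n₀
  have hβ1 : h₂ / h₁ * h₁ = h₂ := div_mul_cancel₀ _ n₁
  set γ := -(β * ((j + 2) * α + (j + 3) * α')) with hγ
  have e1 := E.mul H₁.ell.deriv
  have e2 := H₁.ell.deriv.const_mul α
  have e3 := (E'.mul H₁.ell).const_mul (-(j + 3) / 2)
  have e4 := (E.mul H₀.ell).const_mul (-(β * (2 * j + 5)))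
  have e5 := H₀.ell.const_mul γ
  -- The derivative is moved from `p₁` to the test function by integration by parts.
  have key : ∀ Y, IsElliptic (periods τ) Y →
      pairing τ (fun z => wp τ z * deriv p₁ z + α * deriv p₁ z
        + (-(j + 3) / 2) * (wp' τ z * p₁ z)
        + (-(β * (2 * j + 5))) * (wp τ z * p₀ z) + γ * p₀ z) Y =
      -pairing τ p₁ (deriv fun z => wp τ z * Y z) + α * -pairing τ p₁ (deriv Y)
        + (-(j + 3) / 2) * pairing τ p₁ (fun z => wp' τ z * Y z)
        + (-(β * (2 * j + 5))) * pairing τ p₀ (fun z => wp τ z * Y z)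
        + γ * pairing τ p₀ Y := by
    intro Y hY
    rw [pairing_add_left (((e1.add e2).add e3).add e4) e5 hY,
      pairing_add_left ((e1.add e2).add e3) e4 hY, pairing_add_left (e1.add e2) e3 hY,
      pairing_add_left e1 e2 hY]
    simp only [pairing_const_mul_left, pairing_mul_left]
    rw [pairing_deriv H₁.ell (E.mul hY), pairing_deriv H₁.ell hY]
  have hzero := eq_zero_of_pairing hD H₀ ((((e1.add e2).add e3).add e4).add e5) ?_ ?_ ?_ ?_
  · intro z hz
    have := hzero z hz
    rw [hγ] at this
    linear_combination this
  · intro z hz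
    have hd : deriv p₁ (-z) = (-1) ^ (j + 4) * deriv p₁ z := by
      have h1 : (fun w => p₁ (-w)) =ᶠ[𝓝 z] fun w => (-1) ^ (j + 3) * p₁ w := by
        filter_upwards [(periods τ).isClosed_lattice.isOpen_compl.mem_nhds hz] with w hw
        exact H₁.neg w hw
      have h2 := h1.deriv_eq
      rw [deriv_comp_neg, deriv_const_mul _ (H₁.ell.differentiableAt hz)] at h2
      rw [pow_succ]
      linear_combination -h2
    simp only [wp_neg, wp'_neg, H₀.neg z hz, H₁.neg z hz, hd]
    ring
  · have q1 := (K.mul H₁.jet.deriv).cast (M := j + 6) (by ring) rfl rfl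
    have q2 := (H₁.jet.deriv.const_mul α).add_two.cast (M := j + 6) (by ring) rfl rfl
    have q3 := ((K'.mul H₁.jet).const_mul (-(j + 3) / 2)).cast (M := j + 6) (by ring) rfl rfl
    have q4 := ((K.mul H₀.jet).const_mul (-(β * (2 * j + 5)))).add_two.cast (M := j + 6)
      (by ring) rfl rfl
    have q5 := (H₀.jet.const_mul γ).add_two.add_two.cast (M := j + 6) (by ring) rfl rfl
    refine ((((q1.add q2).add q3).add q4).add q5).cast rfl ?_ ?_
    · push_cast; ring
    · push_cast
      refine mul_right_cancel₀ n₀ ?_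
      rw [hα]
      -- The second coefficient vanishes because of the norm relation between `h₀` and `h₁`; the one
      -- between `h₁` and `h₂` plays the same role in the pairing with `p₀`.
      linear_combination (-(j + 2)) * hβ0 - R₀
  · intro Y y hY hl
    rw [key Y hY]
    have l1 := ((K.lead.mul hl).deriv).cast (M := j + 3) (by ring) rfl
    have l2 := hl.deriv.succ.succ.cast (M := j + 3) (by ring) rfl
    have l3 := (K'.lead.mul hl).cast (M := j + 3) (by ring) rfl
    have l4 := (K.lead.mul hl).cast (M := j + 2) (by ring) rfl
    have l5 := hl.succ.succ
    rw [H₁.pairing_lead _ _ (E.mul hY).deriv l1, H₁.pairing_lead _ _ hY.deriv l2,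
      H₁.pairing_lead _ _ (E'.mul hY) l3, H₀.pairing_lead _ _ (E.mul hY) l4,
      H₀.pairing_lead _ _ hY l5]
    push_cast
    linear_combination (-(2 * j + 5) * y) * hβ0
  · rw [key _ H₀.ell]
    have l1 := (K.mul H₀.jet).deriv.cast (M := j + 3 + 2) (by ring) rfl rfl
    have l2 := H₀.jet.lead.deriv
    have l3 := (K'.mul H₀.jet).cast (M := j + 3 + 2) (by ring) rfl rfl
    have l4 := (K.mul H₀.jet).cast (M := j + 2 + 2) (by ring) rfl rfl
    rw [T₁ _ _ _ (E.mul H₀.ell).deriv l1, H₁.pairing_lead _ _ H₀.ell.deriv l2,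
      T₁ _ _ _ (E'.mul H₀.ell) l3, T₀ _ _ _ (E.mul H₀.ell) l4,
      H₀.pairing_lead _ _ H₀.ell H₀.jet.lead]
    push_cast
    rw [hγ, hα', S]
    rw [S] at R₁
    linear_combination (-(2 * j + 5) * (t₀ + c₀) - ((j + 2) * α + (j + 3) * (-t₀ + t₁ - h₂ / h₁)))
      * hβ0 + (j + 3) * hβ1 + R₁

end EllipticOP
end

/-! ### Parity, expansions and norms of the elliptic orthogonal polynomials. -/

noncomputable section

namespace EllipticOP

open Filter Topology PeriodPair

variable {X Y Z p : ℂ → ℂ} {N M m j : ℕ} {a b c d : ℂ} {τ : UpperHalfPlane}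

lemma apply_zero_of_odd {k : ℂ → ℂ} (hk : AnalyticAt ℂ k 0)
    (hodd : ∀ᶠ z in 𝓝[≠] (0 : ℂ), k (-z) = -k z) : k 0 = 0 := by
  have h1 : Tendsto k (𝓝[≠] 0) (𝓝 (k 0)) := hk.continuousAt.tendsto.mono_left nhdsWithin_le_nhds
  have h2 := h1.comp tendsto_neg_punctured
  exact self_eq_neg.mp (tendsto_nhds_unique h2 (h1.neg.congr' (hodd.mono fun z hz => hz.symm)))

/-- Dividing by `z` four times gives `k₁, …, k₄`; `k₁` and `k₃` are odd, so the coefficients of `z`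
and `z³` vanish. -/
lemma exists_even_expansion {g : ℂ → ℂ} (hg : AnalyticAt ℂ g 0)
    (heven : ∀ᶠ z in 𝓝[≠] (0 : ℂ), g (-z) = g z) :
    ∃ k : ℂ → ℂ, AnalyticAt ℂ k 0 ∧
      ∀ z, g z = g 0 + iteratedDeriv 2 g 0 / 2 * z ^ 2 + z ^ 4 * k z := by
  obtain ⟨k₁, hk₁, -, h₁⟩ := exists_eq_add_mul hg
  obtain ⟨k₂, hk₂, hk₂0, h₂⟩ := exists_eq_add_mul hk₁
  obtain ⟨k₃, hk₃, -, h₃⟩ := exists_eq_add_mul hk₂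
  obtain ⟨k₄, hk₄, -, h₄⟩ := exists_eq_add_mul hk₃
  have o₁ : ∀ᶠ z in 𝓝[≠] (0 : ℂ), k₁ (-z) = -k₁ z := by
    filter_upwards [heven, self_mem_nhdsWithin] with z hz hz0
    have hz0 : z ≠ 0 := hz0
    rw [h₁ z, h₁ (-z)] at hz
    refine mul_left_cancel₀ hz0 ?_
    linear_combination -hz
  have z₁ := apply_zero_of_odd hk₁ o₁
  have o₃ : ∀ᶠ z in 𝓝[≠] (0 : ℂ), k₃ (-z) = -k₃ z := by
    filter_upwards [o₁, self_mem_nhdsWithin] with z hz hz0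
    have hz0 : z ≠ 0 := hz0
    rw [h₂ z, h₂ (-z), h₃ z, h₃ (-z), z₁] at hz
    refine mul_left_cancel₀ (pow_ne_zero 2 hz0) ?_
    linear_combination hz
  have z₃ := apply_zero_of_odd hk₃ o₃
  have hder : iteratedDeriv 2 g 0 = 2 * k₂ 0 := by
    have h1 : deriv g =ᶠ[𝓝 0] fun w => k₁ w + w * deriv k₁ w := by
      filter_upwards [hk₁.eventually_analyticAt] with w hw
      have : HasDerivAt g (1 * k₁ w + w * deriv k₁ w) w := by
        have h0 : g = fun w => g 0 + w * k₁ w := funext h₁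
        rw [h0]
        exact ((hasDerivAt_id' w).mul hw.differentiableAt.hasDerivAt).const_add _
      rw [this.deriv, one_mul]
    rw [iteratedDeriv_succ, iteratedDeriv_one, h1.deriv_eq, hk₂0]
    have h2 : HasDerivAt (fun w => k₁ w + w * deriv k₁ w)
        (deriv k₁ 0 + (1 * deriv k₁ 0 + 0 * deriv (deriv k₁) 0)) 0 :=
      hk₁.differentiableAt.hasDerivAt.add
        ((hasDerivAt_id' 0).mul hk₁.deriv.differentiableAt.hasDerivAt)
    rw [h2.deriv]; ring
  refine ⟨k₄, hk₄, fun z => ?_⟩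
  rw [h₁ z, h₂ z, h₃ z, h₄ z, z₁, z₃, hder]
  ring

namespace IsMonicEllipticPoly

lemma isElliptic (hp : IsMonicEllipticPoly τ m p) : IsElliptic (periods τ) p :=
  ⟨add_coe_of_periodic hp.periodic_one hp.periodic_tau, hp.holo⟩

/-- The bound `monic` makes the extension by `1` continuous at `0`, and a continuous isolated
singularity is removable. -/
lemma analyticAt_update (hp : IsMonicEllipticPoly τ m p) :
    AnalyticAt ℂ (Function.update (fun z : ℂ => z ^ m * p z) 0 1) 0 := by
  refine Complex.analyticAt_of_differentiable_on_punctured_nhds_of_continuousAt ?_ ?_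
  · filter_upwards [notMem_lattice_of_near_zero (periods τ), self_mem_nhdsWithin] with z hz hz0
    have hd : DifferentiableAt ℂ (fun z : ℂ => z ^ m * p z) z :=
      (by fun_prop : DifferentiableAt ℂ (fun z : ℂ => z ^ m) z).mul
        (hp.isElliptic.differentiableAt hz)
    refine hd.congr_of_eventuallyEq ?_
    filter_upwards [isOpen_compl_singleton.mem_nhds hz0] with w hw
    exact Function.update_of_ne hw _ _
  · rw [continuousAt_update_same]
    have h1 : Tendsto (fun z : ℂ => z) (𝓝[≠] 0) (𝓝 0) := tendsto_id.mono_left nhdsWithin_le_nhds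
    have h2 := (hp.monic.trans_tendsto h1).add_const 1
    simpa using h2

lemma eventually_eq_update (m : ℕ) (p : ℂ → ℂ) : ∀ᶠ z in 𝓝[≠] (0 : ℂ),
    z ^ m * p z = Function.update (fun z : ℂ => z ^ m * p z) 0 1 z := by
  filter_upwards [self_mem_nhdsWithin] with z hz
  have hz : z ≠ 0 := hz
  rw [Function.update_of_ne hz]

lemma lead (hp : IsMonicEllipticPoly τ m p) : Lead m 1 p :=
  ⟨_, hp.analyticAt_update, Function.update_self _ _ _, eventually_eq_update m p⟩

end IsMonicEllipticPoly

lemma normConst_eq_pairing (π : ℕ → ℂ → ℂ) (m : ℕ) :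
    normConst τ π m = pairing τ (π m) (π m) := by
  simp only [normConst, pairing, sq]

/-- Orthogonal polynomials are even or odd, by uniqueness. -/
lemma IsEOP.neg (hp : IsEOP τ (j + 2) p) (hD : momentDet τ (j + 2) ≠ 0) :
    ∀ z ∉ (periods τ).lattice, p (-z) = (-1) ^ (j + 2) * p z := by
  have he := hp.monicPoly.isElliptic
  have hl := hp.monicPoly.lead
  have hd : Lead (j + 1 + 1) 0 fun z => p (-z) - (-1) ^ (j + 2) * p z := by
    simpa using hl.comp_neg.sub (hl.const_mul ((-1) ^ (j + 2)))
  obtain ⟨b, hb⟩ := hd.lower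
  have hq := he.comp_neg.sub (he.const_mul ((-1) ^ (j + 2)))
  intro z hz
  refine sub_eq_zero.mp (eq_zero_of_orthogonal hD hq hb (fun k hk hk1 => ?_) z hz)
  have hE := isElliptic_basisFun τ k
  have h0 : pairing τ p (basisFun τ k) = 0 := hp.orthogonal k hk hk1
  have h1 : pairing τ (fun z => p (-z)) (basisFun τ k) = 0 := by
    unfold pairing
    rw [← gammaInt_comp_neg (he.comp_neg.mul hE)]
    simp only [neg_neg, basisFun_neg, mul_left_comm _ ((-1 : ℂ) ^ k)]
    rw [gammaInt_const_mul]
    unfold pairing at h0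
    rw [h0, mul_zero]
  have h2 := pairing_add_left he.comp_neg (he.const_mul (-(-1) ^ (j + 2))) hE
  simp only [neg_mul, ← sub_eq_add_neg] at h2
  rw [h2, h1, zero_add]
  have h3 := pairing_const_mul_left (τ := τ) (-(-1) ^ (j + 2)) p (basisFun τ k)
  simp only [neg_mul] at h3
  rw [h3, h0, mul_zero, neg_zero]

lemma IsEOP.orthPoly {π : ℕ → ℂ → ℂ} (hp : IsEOP τ (j + 2) (π (j + 2)))
    (hD : momentDet τ (j + 2) ≠ 0) :
    OrthPoly τ (j + 2) (π (j + 2)) (laurentCoeff π 2 (j + 2)) (normConst τ π (j + 2)) := by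
  have he := hp.monicPoly.isElliptic
  have hl := hp.monicPoly.lead
  refine ⟨he, ?_, hp.neg hD, fun Y a hY hYl => ?_⟩
  · obtain ⟨k, hk, hgk⟩ := exists_even_expansion hp.monicPoly.analyticAt_update (by
      filter_upwards [self_mem_nhdsWithin, notMem_lattice_of_near_zero (periods τ)] with z hz0 hz
      have hz0 : z ≠ 0 := hz0
      rw [Function.update_of_ne hz0, Function.update_of_ne (neg_ne_zero.mpr hz0), hp.neg hD z hz,
        neg_pow z]
      have hs : ((-1 : ℂ) ^ (j + 2)) * (-1) ^ (j + 2) = 1 := by rw [← mul_pow]; simp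
      linear_combination (z ^ (j + 2) * π (j + 2) z) * hs)
    refine ⟨k, hk, ?_⟩
    filter_upwards [IsMonicEllipticPoly.eventually_eq_update (j + 2) (π (j + 2))] with z hz
    rw [hz, hgk z, Function.update_self]
    rfl
  · have hd : Lead (j + 1 + 1) 0 fun z => Y z - a * π (j + 2) z := by
      simpa using hYl.sub (hl.const_mul a)
    obtain ⟨b, hb⟩ := hd.lower
    have h0 := pairing_eq_zero_of_lead he hp.orthogonal (hY.sub (he.const_mul a)) hb
    have h1 := pairing_add_left (hY.sub (he.const_mul a)) (he.const_mul a) he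
    simp only [sub_add_cancel] at h1
    rw [pairing_comm, h1, pairing_comm, h0, pairing_const_mul_left, normConst_eq_pairing, zero_add]

/-- If `h_m = 0`, then `π_m` is orthogonal to all degrees up to `m`, and `D_{m+1} ≠ 0` makes it
vanish. -/
lemma IsEOP.normConst_ne_zero {π : ℕ → ℂ → ℂ} (hp : IsEOP τ (j + 2) (π (j + 2)))
    (hD : momentDet τ (j + 2) ≠ 0) (hD' : momentDet τ (j + 3) ≠ 0) :
    normConst τ π (j + 2) ≠ 0 := by
  intro h0
  have H := hp.orthPoly hD
  have hz := eq_zero_of_orthogonal (m := j + 1) hD' H.ell H.jet.lead fun k hk hk1 => by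
    rcases Nat.lt_succ_iff_lt_or_eq.mp hk with hk | rfl
    · exact hp.orthogonal k hk hk1
    · rw [H.pairing_lead _ _ (isElliptic_basisFun τ _) (lead_basisFun τ hk1), h0, mul_zero]
  obtain ⟨z, h1, h2⟩ := ((H.jet.lead.eventually_ne one_ne_zero).and
    (notMem_lattice_of_near_zero (periods τ))).exists
  exact h1 (hz z h2)

/-! ### The zeta function and the Taylor coefficients of the Cauchy transform. -/

lemma isElliptic_iteratedDeriv_wp (τ : UpperHalfPlane) (m : ℕ) :
    IsElliptic (periods τ) (iteratedDeriv m (wp τ)) := by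
  induction m with
  | zero => simpa using isElliptic_wp τ
  | succ m ih => rw [iteratedDeriv_succ]; exact ih.deriv

lemma jet_iteratedDeriv_wp (τ : UpperHalfPlane) (m : ℕ) :
    Jet (m + 2) ((-1) ^ m * (m + 1).factorial) 0 (iteratedDeriv m (wp τ)) := by
  induction m with
  | zero => simpa using jet_wp τ
  | succ m ih =>
    rw [iteratedDeriv_succ]
    refine ih.deriv.cast (by ring) ?_ (by ring)
    rw [Nat.factorial_succ (m + 1)]
    push_cast
    ring

/-- The summand equals `s² / (l² (s - l))`, so it decays like `‖l‖⁻³`, which is summable over a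
planar lattice. -/
lemma one_div_sub_bound (r : ℝ) (hr : 0 < r) (s : ℂ) (hs : ‖s‖ < r) (l : ℂ) (h : 2 * r ≤ ‖l‖) :
    ‖1 / (s - l) + 1 / l + s / l ^ 2‖ ≤ 2 * r ^ 2 * ‖l‖ ^ (-3 : ℝ) := by
  have hl0 : 0 < ‖l‖ := by linarith
  have hl : l ≠ 0 := norm_pos_iff.mp hl0
  have hsl : s - l ≠ 0 := sub_ne_zero.mpr (by rintro rfl; linarith)
  have h1 : ‖l‖ / 2 ≤ ‖s - l‖ := by
    rw [norm_sub_rev]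
    exact le_trans (by linarith) (norm_sub_norm_le l s)
  have h2 : 1 / (s - l) + 1 / l + s / l ^ 2 = s ^ 2 / (l ^ 2 * (s - l)) := by
    field_simp; ring
  rw [h2, norm_div, norm_mul, norm_pow, norm_pow]
  calc ‖s‖ ^ 2 / (‖l‖ ^ 2 * ‖s - l‖) ≤ r ^ 2 / (‖l‖ ^ 2 * (‖l‖ / 2)) := by gcongr
    _ = 2 * r ^ 2 / ‖l‖ ^ 3 := by field_simp
    _ = _ := by norm_cast

lemma hasSumLocallyUniformly_wzeta (τ : UpperHalfPlane) :
    HasSumLocallyUniformly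
      (fun (l : (periods τ).lattice) (z : ℂ) => 1 / (z - l) + 1 / (l : ℂ) + z / (l : ℂ) ^ 2)
      (wzeta τ) := by
  refine (periods τ).hasSumLocallyUniformly_aux (u := (2 * · ^ 2 * ‖·‖ ^ (-3 : ℝ))) _
    (fun _ _ => (ZLattice.summable_norm_rpow _ _ (by simp; norm_num)).mul_left _) fun r hr =>
    Filter.eventually_atTop.mpr ⟨2 * r, ?_⟩
  rintro _ h s hs l rfl
  exact one_div_sub_bound r hr s hs l h

lemma hasDerivAt_wzeta_summand {L : PeriodPair} {z : ℂ} (hz : z ∉ L.lattice) (l : L.lattice) :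
    HasDerivAt (fun z : ℂ => 1 / (z - l) + 1 / (l : ℂ) + z / (l : ℂ) ^ 2)
      (-(1 / (z - l) ^ 2 - 1 / (l : ℂ) ^ 2)) z := by
  have h0 : z - l ≠ 0 := sub_ne_zero.mpr (by rintro rfl; exact hz l.2)
  have h1 := (((hasDerivAt_id' z).sub_const (l : ℂ)).fun_inv h0)
  have h2 := (h1.add_const (1 / (l : ℂ))).add ((hasDerivAt_id' z).div_const ((l : ℂ) ^ 2))
  simp only [← one_div] at h2
  refine h2.congr_deriv ?_
  ring

lemma differentiableOn_wzeta (τ : UpperHalfPlane) :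
    DifferentiableOn ℂ (wzeta τ) ((periods τ).lattice : Set ℂ)ᶜ :=
  (hasSumLocallyUniformly_wzeta τ).hasSumLocallyUniformlyOn.differentiableOn
    (.of_forall fun _ => .fun_sum fun i _ _ hz =>
      (hasDerivAt_wzeta_summand hz i).differentiableAt.differentiableWithinAt)
    (periods τ).isClosed_lattice.isOpen_compl

lemma deriv_wzeta {z : ℂ} (hz : z ∉ (periods τ).lattice) : deriv (wzeta τ) z = -wp τ z := by
  have h1 := ((hasSumLocallyUniformly_wzeta τ).tendstoLocallyUniformlyOn
    (s := ((periods τ).lattice : Set ℂ)ᶜ)).deriv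
    (.of_forall fun s => .fun_sum fun i _ _ hz =>
      (hasDerivAt_wzeta_summand hz i).differentiableAt.differentiableWithinAt)
    (periods τ).isClosed_lattice.isOpen_compl
  have h2 := h1.tendsto_at hz
  refine tendsto_nhds_unique h2 ?_
  have h3 := ((periods τ).hasSum_weierstrassP z).neg
  refine h3.congr' (Eventually.of_forall fun s => ?_)
  simp only [Function.comp_apply]
  rw [deriv_fun_sum fun i _ => (hasDerivAt_wzeta_summand hz i).differentiableAt]
  exact Finset.sum_congr rfl fun i _ => (hasDerivAt_wzeta_summand hz i).deriv.symm

end EllipticOP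
end

noncomputable section

namespace EllipticOP

open Filter Topology PeriodPair

variable {X Y Z p : ℂ → ℂ} {N M m j : ℕ} {a b c d : ℂ} {τ : UpperHalfPlane}

/-- Points of `γ - z` have imaginary part strictly between `0` and `Im τ`. On this strip the Cauchy
transform can be differentiated under the integral. -/
lemma gamma_sub_notMem {z : ℂ} (hz : |z.im| < τ.im / 2) (x : ℝ) :
    (τ : ℂ) / 2 + x - z ∉ (periods τ).lattice := by
  intro h
  obtain ⟨m, n, h⟩ := mem_lattice.mp h
  have him := congrArg Complex.im h
  simp only [periods, mul_one, Complex.add_im, Complex.sub_im, Complex.intCast_im, zero_add,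
    Complex.mul_im, Complex.intCast_re, zero_mul, add_zero, Complex.ofReal_im,
    UpperHalfPlane.coe_im] at him
  have h2 : ((τ : ℂ) / 2).im = τ.im / 2 := by simp
  rw [h2] at him
  obtain ⟨h3, h4⟩ := abs_lt.mp hz
  have hpos := τ.im_pos
  have h5 : (0 : ℝ) < n := by
    by_contra hn
    nlinarith
  have h6 : (n : ℝ) < 1 := by
    by_contra hn
    nlinarith
  have h7 : (0 : ℤ) < n := by exact_mod_cast h5
  have h8 : n < (1 : ℤ) := by exact_mod_cast h6
  omega

lemma isOpen_strip (τ : UpperHalfPlane) : IsOpen {z : ℂ | |z.im| < τ.im / 2} :=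
  isOpen_lt (by fun_prop) continuous_const

/-- `F` is not assumed periodic, so that it may be `ζ` as well as a derivative of `℘`. The
dominating constant comes from compactness of a closed disc times `[0, 1]`. -/
lemma hasDerivAt_gammaInt_shift {F : ℂ → ℂ} (hp : IsElliptic (periods τ) p)
    (hF : DifferentiableOn ℂ F ((periods τ).lattice : Set ℂ)ᶜ) {z : ℂ} (hz : |z.im| < τ.im / 2) :
    HasDerivAt (fun z => gammaInt τ fun w => p w * F (w - z))
      (-(gammaInt τ fun w => p w * deriv F (w - z))) z := by
  have hopen : IsOpen ((periods τ).lattice : Set ℂ)ᶜ := (periods τ).isClosed_lattice.isOpen_compl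
  have hF' := hF.deriv hopen
  obtain ⟨r, hr, hball⟩ := Metric.nhds_basis_closedBall.mem_iff.mp ((isOpen_strip τ).mem_nhds hz)
  have hcF : ∀ u : ℂ, |u.im| < τ.im / 2 → Continuous fun x : ℝ =>
      p ((τ : ℂ) / 2 + x) * F ((τ : ℂ) / 2 + x - u) := fun u hu =>
    (continuous_gamma hp).mul (hF.continuousOn.comp_continuous (by fun_prop) fun x =>
      gamma_sub_notMem hu x)
  have hcF' : ContinuousOn (fun q : ℂ × ℝ =>
      p ((τ : ℂ) / 2 + q.2) * -deriv F ((τ : ℂ) / 2 + q.2 - q.1))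
      (Metric.closedBall z r ×ˢ Set.Icc 0 1) := by
    refine ContinuousOn.mul ?_ (ContinuousOn.neg ?_)
    · exact ((continuous_gamma hp).comp continuous_snd).continuousOn
    · exact hF'.continuousOn.comp (by fun_prop) fun q hq => gamma_sub_notMem (hball hq.1) q.2
  obtain ⟨C, hC⟩ := ((isCompact_closedBall z r).prod isCompact_Icc).exists_bound_of_continuousOn hcF'
  have hmeas : Continuous fun x : ℝ =>
      p ((τ : ℂ) / 2 + x) * -deriv F ((τ : ℂ) / 2 + x - z) :=
    (continuous_gamma hp).mul (hF'.continuousOn.comp_continuous (by fun_prop) fun x =>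
      gamma_sub_notMem hz x).neg
  have key := (intervalIntegral.hasDerivAt_integral_of_dominated_loc_of_deriv_le
    (μ := MeasureTheory.volume) (a := 0) (b := 1) (bound := fun _ => C)
    (F := fun u (x : ℝ) => p ((τ : ℂ) / 2 + x) * F ((τ : ℂ) / 2 + x - u))
    (F' := fun u (x : ℝ) => p ((τ : ℂ) / 2 + x) * -deriv F ((τ : ℂ) / 2 + x - u))
    (Metric.closedBall_mem_nhds z hr) ?_ ((hcF z hz).intervalIntegrable _ _)
    hmeas.aestronglyMeasurable ?_ intervalIntegrable_const ?_).2
  · refine key.congr_deriv ?_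
    unfold gammaInt
    rw [← intervalIntegral.integral_neg]
    simp only [mul_neg]
  · filter_upwards [(isOpen_strip τ).mem_nhds hz] with u hu
    exact (hcF u hu).aestronglyMeasurable
  · refine Eventually.of_forall fun x hx u hu => hC (u, x) ⟨hu, ?_⟩
    rw [Set.uIoc_of_le zero_le_one] at hx
    exact ⟨hx.1.le, hx.2⟩
  · refine Eventually.of_forall fun x _ u hu => ?_
    have h1 := (hF.differentiableAt (hopen.mem_nhds (gamma_sub_notMem (hball hu) x))).hasDerivAt
    exact (h1.comp_const_sub ((τ : ℂ) / 2 + x) u).const_mul _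

/-- Each derivative in `z` contributes a factor `-1`; the first one is absorbed by `ζ' = -℘`. -/
lemma iteratedDeriv_cauchyTransform (hp : IsElliptic (periods τ) p) (k : ℕ) {z : ℂ}
    (hz : |z.im| < τ.im / 2) :
    iteratedDeriv (k + 1) (cauchyTransform τ p) z = (2 * (Real.pi : ℂ) * Complex.I)⁻¹ *
      ((-1) ^ k * gammaInt τ fun w => p w * iteratedDeriv k (wp τ) (w - z)) := by
  induction k generalizing z with
  | zero =>
    rw [iteratedDeriv_one]
    have h1 := ((hasDerivAt_gammaInt_shift hp (differentiableOn_wzeta τ) hz).sub_const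
      (gammaInt τ fun w => p w * wzeta τ w)).const_mul (2 * (Real.pi : ℂ) * Complex.I)⁻¹
    have h2 : cauchyTransform τ p =ᶠ[𝓝 z] fun z => (2 * (Real.pi : ℂ) * Complex.I)⁻¹ *
        ((gammaInt τ fun w => p w * wzeta τ (w - z)) - gammaInt τ fun w => p w * wzeta τ w) := by
      filter_upwards [(isOpen_strip τ).mem_nhds hz] with u hu
      unfold cauchyTransform gammaInt
      rw [← intervalIntegral.integral_sub]
      · simp only [mul_sub]
      · exact ((continuous_gamma hp).mul ((differentiableOn_wzeta τ).continuousOn.comp_continuous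
          (by fun_prop) fun x => gamma_sub_notMem hu x)).intervalIntegrable _ _
      · exact ((continuous_gamma hp).mul ((differentiableOn_wzeta τ).continuousOn.comp_continuous
          (by fun_prop) fun x => gamma_notMem τ x)).intervalIntegrable _ _
    rw [h2.deriv_eq, h1.deriv]
    have h3 : (gammaInt τ fun w => p w * deriv (wzeta τ) (w - z)) =
        gammaInt τ fun w => -1 * (p w * wp τ (w - z)) :=
      intervalIntegral.integral_congr fun x _ => by
        simp only [deriv_wzeta (gamma_sub_notMem hz x)]
        ring
    rw [h3, gammaInt_const_mul]
    simp
  | succ k ih =>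
    rw [iteratedDeriv_succ]
    have h2 : iteratedDeriv (k + 1) (cauchyTransform τ p) =ᶠ[𝓝 z] fun z =>
        (2 * (Real.pi : ℂ) * Complex.I)⁻¹ *
          ((-1) ^ k * gammaInt τ fun w => p w * iteratedDeriv k (wp τ) (w - z)) := by
      filter_upwards [(isOpen_strip τ).mem_nhds hz] with u hu
      exact ih hu
    have h1 := ((hasDerivAt_gammaInt_shift hp (isElliptic_iteratedDeriv_wp τ k).diff hz).const_mul
      ((-1 : ℂ) ^ k)).const_mul (2 * (Real.pi : ℂ) * Complex.I)⁻¹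
    rw [h2.deriv_eq, h1.deriv]
    simp only [iteratedDeriv_succ, pow_succ]
    ring

lemma cauchyCoeff_two (π : ℕ → ℂ → ℂ) (hp : IsElliptic (periods τ) (π m))
    (hh : normConst τ π m ≠ 0) :
    normConst τ π m * cauchyCoeff τ π 2 m =
      (-1) ^ m / (m + 1).factorial * pairing τ (π m) (iteratedDeriv m (wp τ)) := by
  have h0 := iteratedDeriv_cauchyTransform hp m (z := 0)
    (by simpa using τ.im_pos)
  simp only [sub_zero] at h0
  unfold cauchyCoeff
  rw [show m + 2 - 1 = m + 1 by omega, h0, pairing]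
  have h1 : (2 * (Real.pi : ℂ) * Complex.I) ≠ 0 := Complex.two_pi_I_ne_zero
  field_simp

/-- With `m = j + 2`, `Y` equals `a e ℘^(m) + b π_m` up to terms of lower degree, where `e`
normalizes the leading coefficient of `℘^(m)`. The pairing of `π_m` with `℘^(m)` is the Cauchy
coefficient by `cauchyCoeff_two`. -/
lemma IsEOP.hasTail {π : ℕ → ℂ → ℂ} (hp : IsEOP τ (j + 2) (π (j + 2)))
    (hD : momentDet τ (j + 2) ≠ 0) (hh : normConst τ π (j + 2) ≠ 0) :
    HasTail τ (j + 2) (π (j + 2)) (cauchyCoeff τ π 2 (j + 2)) (normConst τ π (j + 2)) := by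
  intro Y a b hY hYj
  have H := hp.orthPoly hD
  set e : ℂ := (-1) ^ (j + 2) / (j + 2 + 1).factorial with he
  set E := iteratedDeriv (j + 2) (wp τ) with hE
  have hEe : IsElliptic (periods τ) E := isElliptic_iteratedDeriv_wp τ (j + 2)
  have hJ := jet_iteratedDeriv_wp τ (j + 2)
  have hfac : ((j + 2 + 1).factorial : ℂ) ≠ 0 := by exact_mod_cast Nat.factorial_ne_zero _
  have hs : ((-1 : ℂ) ^ (j + 2)) * (-1) ^ (j + 2) = 1 := by rw [← mul_pow]; simp
  have hone : e * ((-1) ^ (j + 2) * ((j + 2 + 1).factorial : ℂ)) = 1 := by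
    rw [he]; field_simp; linear_combination hs
  have hJ0 : Jet (j + 4) 0 0 fun z => Y z - a * e * E z - b * π (j + 2) z := by
    refine ((hYj.sub (hJ.const_mul (a * e))).sub (H.jet.const_mul b).add_two).cast rfl ?_ ?_
    · rw [mul_assoc, hone]; ring
    · ring
  obtain ⟨q, hq⟩ := Jet.lead_of_zero hJ0
  have e1 := hEe.const_mul (a * e)
  have e2 := H.ell.const_mul b
  have hz := OrthPoly.pairing_eq_zero (m := j + 1) H ((hY.sub e1).sub e2) hq.succ
  have h1 := pairing_add_left ((hY.sub e1).sub e2) (e1.add e2) H.ell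
  have h2 : (fun z => Y z - a * e * E z - b * π (j + 2) z + (a * e * E z + b * π (j + 2) z)) = Y :=
    funext fun z => by ring
  rw [h2, pairing_comm, pairing_comm (Y := π (j + 2)), hz, pairing_add_left e1 e2 H.ell,
    pairing_const_mul_left, pairing_const_mul_left, ← normConst_eq_pairing,
    pairing_comm (X := E)] at h1
  have h3 := cauchyCoeff_two π H.ell hh
  rw [h1]
  linear_combination -a * h3

end EllipticOP
end

/-! ### Compatibility as a polynomial identity in `℘`, and the recurrences. -/

noncomputable section

namespace EllipticOP

open Filter Topology PeriodPair

variable {τ : UpperHalfPlane}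

lemma wp'_sq {z : ℂ} (hz : z ∉ (periods τ).lattice) :
    wp' τ z ^ 2 = 4 * wp τ z ^ 3 - (periods τ).g₂ * wp τ z - (periods τ).g₃ :=
  (periods τ).derivWeierstrassP_sq z hz

/-- `℘'' - 6 ℘²` has no pole, hence is constant; differentiating the equation for `℘'²` at a point
with `℘' ≠ 0` identifies the constant. -/
lemma deriv_wp' {z : ℂ} (hz : z ∉ (periods τ).lattice) :
    deriv (wp' τ) z = 6 * wp τ z ^ 2 - (periods τ).g₂ / 2 := by
  have E := isElliptic_wp τ
  have E' := isElliptic_wp' τ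
  have K := jet_wp τ
  have hell := E'.deriv.sub ((E.mul E).const_mul 6)
  have hjet : Jet (0 + 4) 0 0 fun z => deriv (wp' τ) z - 6 * (wp τ z * wp τ z) := by
    refine ((jet_wp' τ).deriv.sub ((K.mul K).const_mul 6)).cast rfl ?_ ?_
    · norm_num
    · norm_num
  obtain ⟨e, he⟩ := hjet.lead_of_zero
  obtain ⟨w, hw0, hw⟩ := (((jet_wp' τ).lead.eventually_ne (by norm_num)).and
    (notMem_lattice_of_near_zero (periods τ))).exists
  have h1 := hell.eq_const he hw
  have h2 : (fun u => wp' τ u ^ 2) =ᶠ[𝓝 w] fun u =>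
      4 * wp τ u ^ 3 - (periods τ).g₂ * wp τ u - (periods τ).g₃ := by
    filter_upwards [(periods τ).isClosed_lattice.isOpen_compl.mem_nhds hw] with u hu
    exact wp'_sq hu
  have hd : HasDerivAt (wp τ) (wp' τ w) w := deriv_wp τ ▸ (E.differentiableAt hw).hasDerivAt
  have hd' := (E'.differentiableAt hw).hasDerivAt
  have h3 := h2.deriv_eq
  rw [(hd'.fun_pow 2).deriv,
    ((((hd.fun_pow 3).const_mul 4).fun_sub (hd.const_mul (periods τ).g₂)).sub_const _).deriv] at h3
  have h4 : e = -(periods τ).g₂ / 2 := by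
    rw [← h1]
    refine mul_left_cancel₀ hw0 ?_
    norm_num at h3
    linear_combination h3 / 2
  have h5 := hell.eq_const he hz
  rw [h4] at h5
  linear_combination h5

/-- For each of the finitely many roots `r`, the function `℘ - r` has a pole at `0` and so is
nonzero nearby. -/
lemma eval_eq_zero_of_near_zero {Q : Polynomial ℂ}
    (h : ∀ᶠ z in 𝓝[≠] (0 : ℂ), Q.eval (wp τ z) = 0) : Q = 0 := by
  by_contra hQ
  have h1 : ∀ r ∈ Q.roots.toFinset, ∀ᶠ z in 𝓝[≠] (0 : ℂ), wp τ z - r ≠ 0 := fun r _ =>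
    ((jet_wp τ).sub (Jet.const r).add_two).lead.eventually_ne (by norm_num)
  have h2 := (Filter.eventually_all_finset Q.roots.toFinset).mpr h1
  obtain ⟨z, h3, h4⟩ := (h.and h2).exists
  exact h4 (wp τ z) (by simpa [hQ] using h3) (sub_self _)

/-- The polynomial in `x = ℘` whose vanishing expresses the compatibility condition. -/
def compatPoly (g₂ g₃ : ℂ) (α β : ℕ → ℂ) (n : ℕ) (x : ℂ) : ℂ :=
  (4 * x ^ 3 - g₂ * x - g₃) * ((2 - n) * (x + α (n + 1)) + (n + 1) * (x + α n))
    - (12 * x ^ 2 - g₂) * (x + α n) * (x + α (n + 1))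
    - 4 * β (n + 1) * (n * (x + α (n + 1)) + (n + 1) * (x + α (n + 2))) * (x + α n) ^ 2
    - 4 * β n * (x + α (n + 1)) ^ 2 * ((2 - n) * (x + α (n - 1)) + (1 - n) * (x + α n))

lemma compatPoly_eq_zero {g₂ g₃ : ℂ} {α β : ℕ → ℂ} {n : ℕ}
    (h : ∀ᶠ z in 𝓝[≠] (0 : ℂ), compatPoly g₂ g₃ α β n (wp τ z) = 0) (x : ℂ) :
    compatPoly g₂ g₃ α β n x = 0 := by
  let C : ℂ →+* Polynomial ℂ := Polynomial.C
  let x' : Polynomial ℂ := Polynomial.X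
  let Q : Polynomial ℂ :=
    (4 * x' ^ 3 - C g₂ * x' - C g₃) *
        ((2 - n) * (x' + C (α (n + 1))) + (n + 1) * (x' + C (α n)))
      - (12 * x' ^ 2 - C g₂) * (x' + C (α n)) * (x' + C (α (n + 1)))
      - 4 * C (β (n + 1)) * (n * (x' + C (α (n + 1))) + (n + 1) * (x' + C (α (n + 2))))
        * (x' + C (α n)) ^ 2
      - 4 * C (β n) * (x' + C (α (n + 1))) ^ 2
        * ((2 - n) * (x' + C (α (n - 1))) + (1 - n) * (x' + C (α n)))
  have hQ : ∀ y, Q.eval y = compatPoly g₂ g₃ α β n y := fun y => by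
    simp [Q, C, x', compatPoly]
  rw [← hQ, eval_eq_zero_of_near_zero (h.mono fun z hz => (hQ _).trans hz), Polynomial.eval_zero]

lemma hasDerivAt_fFun (α : ℕ → ℂ) (n : ℕ) {z : ℂ} (hz : z ∉ (periods τ).lattice) :
    HasDerivAt (fFun τ α n) (wp' τ z) z :=
  (deriv_wp τ ▸ ((isElliptic_wp τ).differentiableAt hz).hasDerivAt :
    HasDerivAt (wp τ) (wp' τ z) z).add_const _

lemma fFun_eventually_ne (α : ℕ → ℂ) (n : ℕ) : ∀ᶠ z in 𝓝[≠] (0 : ℂ), fFun τ α n z ≠ 0 :=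
  ((jet_wp τ).add (Jet.const (α n)).add_two).lead.eventually_ne (by norm_num)

/-- The left-hand side of the compatibility condition has a single nontrivial entry. -/
lemma compat_matrix {α h : ℕ → ℂ} {n : ℕ} (hn : h n ≠ 0) {z : ℂ} (hz : z ∉ (periods τ).lattice)
    (h1 : fFun τ α n z ≠ 0) (h2 : fFun τ α (n + 1) z ≠ 0) :
    (Matrix.of fun i j => deriv (fun w => RMat τ α h n w i j) z)
      - LMat τ α h (n + 1) z * RMat τ α h n z + RMat τ α h n z * LMat τ α h n z =
    !![compatPoly (periods τ).g₂ (periods τ).g₃ α (ratio h) n (wp τ z) /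
        (4 * fFun τ α n z ^ 2 * fFun τ α (n + 1) z), 0; 0, 0] := by
  have hpi : (2 * (Real.pi : ℂ) * Complex.I) ≠ 0 := Complex.two_pi_I_ne_zero
  have d1 := hasDerivAt_fFun (τ := τ) α n hz
  have d2 := hasDerivAt_fFun (τ := τ) α (n + 1) hz
  have d3 := ((isElliptic_wp' τ).differentiableAt hz).hasDerivAt
  rw [deriv_wp' hz] at d3
  have d0 := d1.fun_inv h1
  have D00 : HasDerivAt (fun w => RMat τ α h n w 0 0) _ z :=
    (d0.mul (d3.neg.div_const 2)).congr_of_eventuallyEq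
      (Eventually.of_forall fun w => by simp [RMat])
  have D01 : HasDerivAt (fun w => RMat τ α h n w 0 1) _ z :=
    (d0.mul (d2.const_mul (-(h n / (2 * (Real.pi : ℂ) * Complex.I))))).congr_of_eventuallyEq
      (Eventually.of_forall fun w => by simp [RMat])
  have D10 : HasDerivAt (fun w => RMat τ α h n w 1 0) _ z :=
    (d0.mul (d1.const_mul (2 * (Real.pi : ℂ) * Complex.I / h n))).congr_of_eventuallyEq
      (Eventually.of_forall fun w => by simp [RMat])
  have D11 : HasDerivAt (fun w => RMat τ α h n w 1 1) 0 z :=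
    (hasDerivAt_const z (0 : ℂ)).congr_of_eventuallyEq
      (Eventually.of_forall fun w => by simp [RMat])
  have hsq := wp'_sq hz
  have e1 : wp τ z + α n = fFun τ α n z := rfl
  have e2 : wp τ z + α (n + 1) = fFun τ α (n + 1) z := rfl
  have e3 : wp τ z + α (n + 2) = fFun τ α (n + 2) z := rfl
  have e4 : wp τ z + α (n - 1) = fFun τ α (n - 1) z := rfl
  ext i j
  fin_cases i <;> fin_cases j
  · simp only [Fin.zero_eta, Matrix.add_apply, Matrix.sub_apply, Matrix.of_apply, D00.deriv,
      Matrix.mul_apply, Fin.sum_univ_two]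
    simp only [RMat, LMat, compatPoly, ← hsq, e1, e2, e3, e4, ratio, Matrix.smul_apply,
      Matrix.of_apply, Matrix.cons_val', Matrix.cons_val_zero, Matrix.cons_val_one,
      Matrix.cons_val_fin_one, smul_eq_mul, Nat.add_sub_cancel, Nat.cast_add, Nat.cast_one,
      Pi.neg_apply]
    -- If `h (n - 1) = 0`, the lower left entry of `LMat τ α h n` and `ratio h n` are both `0` by
    -- the convention for division, so the identity persists.
    by_cases hn1 : h (n - 1) = 0
    · rw [hn1]
      simp only [div_zero]
      field_simp
      ring
    · field_simp
      ring
  · simp only [Fin.zero_eta, Fin.mk_one, Matrix.add_apply, Matrix.sub_apply, Matrix.of_apply,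
      D01.deriv, Matrix.mul_apply, Fin.sum_univ_two]
    simp only [RMat, LMat, Matrix.smul_apply,
      Matrix.of_apply, Matrix.cons_val', Matrix.cons_val_zero, Matrix.cons_val_one,
      Matrix.cons_val_fin_one, smul_eq_mul, Nat.add_sub_cancel, Nat.cast_add, Nat.cast_one]
    field_simp
    ring
  · simp only [Fin.zero_eta, Fin.mk_one, Matrix.add_apply, Matrix.sub_apply, Matrix.of_apply,
      D10.deriv, Matrix.mul_apply, Fin.sum_univ_two]
    simp only [RMat, LMat, Matrix.smul_apply,
      Matrix.of_apply, Matrix.cons_val', Matrix.cons_val_zero, Matrix.cons_val_one,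
      Matrix.cons_val_fin_one, smul_eq_mul, Nat.add_sub_cancel, Nat.cast_add, Nat.cast_one]
    field_simp
    ring
  · simp only [Fin.mk_one, Matrix.add_apply, Matrix.sub_apply, Matrix.of_apply,
      D11.deriv, Matrix.mul_apply, Fin.sum_univ_two]
    simp only [RMat, LMat, Matrix.smul_apply,
      Matrix.of_apply, Matrix.cons_val', Matrix.cons_val_zero, Matrix.cons_val_one,
      Matrix.cons_val_fin_one, smul_eq_mul, Nat.add_sub_cancel, Nat.cast_add, Nat.cast_one]
    field_simp
    ring

lemma Compatible.compatPoly_eq_zero {α h : ℕ → ℂ} {n : ℕ} (hn : h n ≠ 0)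
    (hc : Compatible τ α h n) (x : ℂ) :
    compatPoly (periods τ).g₂ (periods τ).g₃ α (ratio h) n x = 0 := by
  refine EllipticOP.compatPoly_eq_zero (τ := τ) ?_ x
  filter_upwards [fFun_eventually_ne α n, fFun_eventually_ne α (n + 1),
    notMem_lattice_of_near_zero (periods τ)] with z h1 h2 hz
  have h3 := hc z hz h1 h2
  rw [compat_matrix hn hz h1 h2] at h3
  have h4 := congrFun (congrFun h3 0) 0
  have h5 : (4 * fFun τ α n z ^ 2 * fFun τ α (n + 1) z) ≠ 0 :=
    mul_ne_zero (mul_ne_zero (by norm_num) (pow_ne_zero 2 h1)) h2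
  exact (div_eq_zero_iff.mp h4).resolve_right h5

lemma compatible_of_compatPoly {α h : ℕ → ℂ} {n : ℕ} (hn : h n ≠ 0)
    (hc : ∀ x, compatPoly (periods τ).g₂ (periods τ).g₃ α (ratio h) n x = 0) :
    Compatible τ α h n := by
  intro z hz h1 h2
  rw [compat_matrix hn hz h1 h2, hc, zero_div]
  ext i j
  fin_cases i <;> fin_cases j <;> rfl

lemma recurrences_of_compatPoly {g₂ g₃ : ℂ} {α β : ℕ → ℂ} {n : ℕ} (hn : 3 ≤ n)
    (hc : ∀ x, compatPoly g₂ g₃ α β n x = 0) : Recurrences g₂ g₃ α β n := by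
  have hn2 : (2 - n : ℂ) ≠ 0 := by
    rw [sub_ne_zero]
    exact_mod_cast (by omega : 2 ≠ n)
  have hn1 : (2 * n - 1 : ℂ) ≠ 0 := by
    rw [sub_ne_zero]
    exact_mod_cast (by omega : 2 * n ≠ 1)
  set a := α n with ha
  set d := α (n + 1) - a with hd
  set e := α (n - 1) - a with he
  set S := -betaNum g₂ g₃ α n with hS
  -- The value of `compatPoly` at `-α_n`, divided by `2 - n`.
  have A : d * (S - 4 * β n * d * e) = 0 := by
    refine mul_left_cancel₀ hn2 ?_
    have := hc (-a)
    unfold compatPoly at this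
    rw [hS, betaNum, hd, he]
    linear_combination this
  -- The derivative of `compatPoly` at `-α_n`, obtained from the symmetric difference formula with
  -- nodes `±1, ±2`, which is exact up to degree 4.
  have B : (1 - n) * (12 * a ^ 2 - g₂) * d + 3 * S - 8 * (2 - n) * β n * d * e
      - 4 * (3 - 2 * n) * β n * d ^ 2 = 0 := by
    have q1 := hc (-a + 1)
    have q2 := hc (-a - 1)
    have q3 := hc (-a + 2)
    have q4 := hc (-a - 2)
    unfold compatPoly at q1 q2 q3 q4
    rw [hS, betaNum, hd, he]
    linear_combination (8 * (q1 - q2) - (q3 - q4)) / 12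
  have hbeta : S = 4 * β n * d * e := by
    -- If `α_{n+1} = α_n`, then `B` reduces to `3 S = 0`, so the cleared relation still holds.
    rcases mul_eq_zero.mp A with h0 | h0
    · rw [h0] at B ⊢
      linear_combination B / 3
    · linear_combination h0
  have hden : d * alphaDen g₂ g₃ α n + (2 * n - 1) * S * e = 0 := by
    have h1 : alphaDen g₂ g₃ α n = (1 - n) * (12 * a ^ 2 - g₂) * e + (2 * n - 3) * S := by
      rw [hS, betaNum, he, alphaDen]; ring
    rw [h1]
    linear_combination e * B + (2 * (n - 2) * e + (2 * n - 3) * d) * hbeta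
  have hmul : β n * betaDen α n = betaNum g₂ g₃ α n := by
    rw [betaDen]
    rw [hd, he] at hbeta
    linear_combination hbeta
  have hamul : α (n + 1) * alphaDen g₂ g₃ α n = alphaNum g₂ g₃ α n := by
    have h1 : alphaNum g₂ g₃ α n = a * alphaDen g₂ g₃ α n - (2 * n - 1) * S * e := by
      rw [hS, betaNum, he, alphaDen, alphaNum]; ring
    rw [h1]
    linear_combination hden
  refine ⟨hmul, hamul, fun h0 => ?_, fun h0 => eq_div_of_mul_eq h0 hmul,
    fun h0 => eq_div_of_mul_eq h0 hamul⟩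
  have hb : betaDen α n ≠ 0 := fun hb => h0 (by rw [← hmul, hb, mul_zero])
  refine ⟨hb, fun h1 => ?_⟩
  rw [h1, mul_zero, zero_add] at hden
  have he0 : e ≠ 0 := fun he0 => hb (by rw [betaDen, ← ha, ← he, he0]; ring)
  exact mul_ne_zero (mul_ne_zero hn1 (neg_ne_zero.mpr h0)) he0 hden

theorem compatible_of_isEOP {π : ℕ → ℂ → ℂ} {j : ℕ}
    (H : ∀ m, j + 2 ≤ m → m ≤ j + 6 → momentDet τ m ≠ 0 ∧ IsEOP τ m (π m)) :
    Compatible τ (alpha τ π) (normConst τ π) (j + 4) := by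
  have D2 := H (j + 2) (by omega) (by omega)
  have D3 := H (j + 3) (by omega) (by omega)
  have D4 := H (j + 4) (by omega) (by omega)
  have D5 := H (j + 5) (by omega) (by omega)
  have D6 := H (j + 6) (by omega) (by omega)
  have P2 := D2.2.orthPoly D2.1
  have P3 := IsEOP.orthPoly (j := j + 1) D3.2 D3.1
  have P4 := IsEOP.orthPoly (j := j + 2) D4.2 D4.1
  have P5 := IsEOP.orthPoly (j := j + 3) D5.2 D5.1
  have P6 := IsEOP.orthPoly (j := j + 4) D6.2 D6.1
  have n2 := D2.2.normConst_ne_zero D2.1 D3.1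
  have n3 := IsEOP.normConst_ne_zero (j := j + 1) D3.2 D3.1 D4.1
  have n4 := IsEOP.normConst_ne_zero (j := j + 2) D4.2 D4.1 D5.1
  have n5 := IsEOP.normConst_ne_zero (j := j + 3) D5.2 D5.1 D6.1
  have T2 := D2.2.hasTail D2.1 n2
  have T3 := IsEOP.hasTail (j := j + 1) D3.2 D3.1 n3
  have T4 := IsEOP.hasTail (j := j + 2) D4.2 D4.1 n4
  have T5 := IsEOP.hasTail (j := j + 3) D5.2 D5.1 n5
  have I3 := OrthPoly.three_term P2 P3 P4 T2 T3 D3.1 n2 n3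
    (α := alpha τ π (j + 3)) (α' := alpha τ π (j + 4)) rfl rfl
  have I4 := OrthPoly.three_term (j := j + 1) P3 P4 P5 T3 T4 D4.1 n3 n4
    (α := alpha τ π (j + 4)) (α' := alpha τ π (j + 5)) rfl rfl
  have II3 := OrthPoly.deriv_relation P2 P3 P4 T2 T3 D3.1 n2 n3
    (α := alpha τ π (j + 3)) (α' := alpha τ π (j + 4)) rfl rfl
  have II4 := OrthPoly.deriv_relation (j := j + 1) P3 P4 P5 T3 T4 D4.1 n3 n4
    (α := alpha τ π (j + 4)) (α' := alpha τ π (j + 5)) rfl rfl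
  have II5 := OrthPoly.deriv_relation (j := j + 2) P4 P5 P6 T4 T5 D5.1 n4 n5
    (α := alpha τ π (j + 5)) (α' := alpha τ π (j + 6)) rfl rfl
  refine compatible_of_compatPoly n4 fun x => compatPoly_eq_zero (τ := τ) ?_ x
  filter_upwards [notMem_lattice_of_near_zero (periods τ),
    fFun_eventually_ne (alpha τ π) (j + 3), P4.jet.lead.eventually_ne one_ne_zero] with z hz hf hp
  have hsq := wp'_sq hz
  have dw : HasDerivAt (wp τ) (wp' τ z) z :=
    deriv_wp τ ▸ ((isElliptic_wp τ).differentiableAt hz).hasDerivAt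
  have dw' := ((isElliptic_wp' τ).differentiableAt hz).hasDerivAt
  rw [deriv_wp' hz] at dw'
  have d3 := (P3.ell.differentiableAt hz).hasDerivAt
  have d4 := (P4.ell.differentiableAt hz).hasDerivAt
  have d5 := (P5.ell.differentiableAt hz).hasDerivAt
  -- With `n = j + 4`, the three-term relation at `n` is differentiated.
  have hD : HasDerivAt (fun z => (wp τ z + alpha τ π (j + 4)) * π (j + 5) z
      + wp' τ z / 2 * π (j + 4) z + normConst τ π (j + 4) / normConst τ π (j + 3)
      * (wp τ z + alpha τ π (j + 5)) * π (j + 3) z) _ z :=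
    (((dw.add_const _).mul d5).add ((dw'.div_const 2).mul d4)).add
      (((dw.add_const _).const_mul _).mul d3)
  have hD0 := hD.unique ((hasDerivAt_const z (0 : ℂ)).congr_of_eventuallyEq (by
    filter_upwards [(periods τ).isClosed_lattice.isOpen_compl.mem_nhds hz] with w hw
    exact I4 w hw))
  have i3 := I3 z hz
  have i4 := I4 z hz
  have ii3 := II3 z hz
  have ii4 := II4 z hz
  have ii5 := II5 z hz
  simp only [show j + 1 + 2 = j + 3 from rfl, show j + 1 + 3 = j + 4 from rfl,
    show j + 1 + 4 = j + 5 from rfl, fFun] at i4 ii4 ii5 hf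
  push_cast at ii4 ii5
  unfold compatPoly ratio
  simp only [show j + 4 + 1 = j + 5 from rfl, show j + 4 + 2 = j + 6 from rfl,
    show j + 4 - 1 = j + 3 from rfl, ← hsq]
  push_cast
  set x := wp τ z
  set y := wp' τ z
  set α₃ := alpha τ π (j + 3)
  set α₄ := alpha τ π (j + 4)
  set α₅ := alpha τ π (j + 5)
  set α₆ := alpha τ π (j + 6)
  set β₃ := normConst τ π (j + 3) / normConst τ π (j + 2)
  set β₄ := normConst τ π (j + 4) / normConst τ π (j + 3)
  set β₅ := normConst τ π (j + 5) / normConst τ π (j + 4)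
  -- The relation for `π_{n-1}'` contains `π_{n-2}`; the three-term relation at `n - 1` replaces it
  -- by `π_n` and `π_{n-1}`, and a factor `f_{n-1}` cancels. After that `π_{n+1}` is eliminated by
  -- the three-term relation at `n`, the terms in `π_{n-1}` cancel, and a multiple of `π_n` remains.
  have ii3' : (x + α₄) * deriv (π (j + 3)) z =
      (-(j + 2) * (x + α₃) - (j + 3) * (x + α₄)) * π (j + 4) z
        - (j + 2) * y / 2 * π (j + 3) z := by
    refine mul_left_cancel₀ hf ?_
    linear_combination (x + α₄) * ii3 + ((j + 2) * (x + α₃) + (j + 3) * (x + α₄)) * i3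
  refine mul_right_cancel₀ hp ?_
  linear_combination (-4 * (x + α₄) * (x + α₅)) * hD0 + 4 * (x + α₄) ^ 2 * ii5
    + 2 * y * (x + α₅) * ii4 + 4 * β₄ * (x + α₅) ^ 2 * ii3'
    + (4 * (x + α₅) * y + 2 * (j + 5) * y * (x + α₄)) * i4

end EllipticOP

end

theorem theorem3p5 (τ : UpperHalfPlane) (n : ℕ) (hn : 4 ≤ n) :
    -- the compatibility condition gives the recurrence relations
    (∀ α h : ℕ → ℂ, h (n - 1) ≠ 0 → h n ≠ 0 → EllipticOP.Compatible τ α h n →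
      EllipticOP.Recurrences (EllipticOP.periods τ).g₂ (EllipticOP.periods τ).g₃
        α (EllipticOP.ratio h) n) ∧
    -- the coefficients of the elliptic orthogonal polynomials satisfy both
    (∀ π : ℕ → ℂ → ℂ,
      (∀ m, n - 2 ≤ m → m ≤ n + 2 → EllipticOP.momentDet τ m ≠ 0 ∧ EllipticOP.IsEOP τ m (π m)) →
      EllipticOP.Compatible τ (EllipticOP.alpha τ π) (EllipticOP.normConst τ π) n ∧
      EllipticOP.Recurrences (EllipticOP.periods τ).g₂ (EllipticOP.periods τ).g₃
        (EllipticOP.alpha τ π) (EllipticOP.ratio (EllipticOP.normConst τ π)) n) := by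
  have key : ∀ α h : ℕ → ℂ, h n ≠ 0 → EllipticOP.Compatible τ α h n →
      EllipticOP.Recurrences (EllipticOP.periods τ).g₂ (EllipticOP.periods τ).g₃
        α (EllipticOP.ratio h) n := fun α h h0 hc =>
    EllipticOP.recurrences_of_compatPoly (by omega) (hc.compatPoly_eq_zero h0)
  refine ⟨fun α h _ h0 hc => key α h h0 hc, fun π H => ?_⟩
  obtain ⟨j, rfl⟩ : ∃ j, n = j + 4 := ⟨n - 4, by omega⟩
  have hc := EllipticOP.compatible_of_isEOP H
  have D4 := H (j + 4) (by omega) (by omega)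
  have D5 := H (j + 5) (by omega) (by omega)
  exact ⟨hc, key _ _ (EllipticOP.IsEOP.normConst_ne_zero (j := j + 2) D4.2 D4.1 D5.1) hc⟩
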